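/- Fix $\alpha>0$, $C>0$ and $\sigma>0$. For $\beta>0$ and $L>0$ let $\text{H\"older}^{\beta}(L)$ be the set of functions $h:\mathbb R\to\mathbb R$ that are $k$ times differentiable and satisfy $|h^{(k)}(t)-h^{(k)}(t')|\le L|t-t'|^{\beta-k}$ for all $t,t'\in\mathbb R$, where $k=k(\beta)$; here either $k(\beta)=\lfloor\beta\rfloor$ for all $\beta$, or $k(\beta)$ is the largest integer strictly smaller than $\beta$ for all $\beta$ (with this second convention $\text{H\"older}^{1}(1)$ is the set of $1$-Lipschitz functions). The result holds with either convention. Let $$H^\alpha(C)=\{f_h : h\in \text{H\"older}^{\alpha}(C)\cap\text{H\"older}^{1}(1)\},\qquad f_h(t_1,t_2)=\mathbf 1_{\{t_2<h(t_1)\}},\quad (t_1,t_2)\in[0,1]^2 .$$ For $n\ge1$ and $0\le i,j\le n-1$ let $x_{i,j}$ be the average of $f$ over the pixel $[\frac in,\frac{i+1}n)\times[\frac jn,\frac{j+1}n)$, and let $y_{i,j}=x_{i,j}+z_{i,j}$ with $z_{i,j}$ i.i.d. $N(0,\sigma^2)$. Extend $y$ to $\mathbb Z^2$ periodically with period $n$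 in each index. For an absolutely summable $g:\mathbb Z^2\to\mathbb R$ with $\sum_{m,\ell}g_{m,\ell}=1$ let $$\hat f^{LF}_g(i,j)=\sum_{m,\ell\in\mathbb Z}g_{m,\ell}\,y_{i-m,j-\ell},\qquad R_n(f,\hat f^{LF}_g)=\mathbb E\Big(\frac1{n^2}\sum_{i,j=0}^{n-1}\big(x_{i,j}-\hat f^{LF}_g(i,j)\big)^2\Big),\qquad \hat G(\omega_1,\omega_2)=\sum_{m,\ell}g_{m,\ell}e^{-\mathrm i(m\omega_1+\ell\omega_2)} .$$ Let $\mathcal G$ be the set of all such filters $g$ that are symmetric ($g_{i,j}=g_{-i,j}=g_{i,-j}$ for all $i,j$), isotropic (there is $F:\mathbb R\to\mathbb C$ with $\hat G(\omega_1,\omega_2)=F(\sqrt{\omega_1^2+\omega_2^2})$ for all $-\pi<\omega_1,\omega_2\le\pi$), and whose Fourier transform $\hat G$ is differentiable with bounded gradient: $\sup_{\omega}\|\operatorname{grad}\hat G(\omega)\|_2<\infty$ (the bound may depend on $g$). Then $$\inf_{g\in\mathcal G}\ \sup_{f\in H^\alpha(C)}R_n(f,\hat f^{LF}_g)\asymp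 n^{-2/3}\qquad(n\to\infty),$$ that is, there are constants $c_1,c_2>0$ and $n_0$, depending only on $\alpha$, $C$, $\sigma$ and the convention for $k$, such that for all $n>n_0$ the left-hand side lies between $c_1n^{-2/3}$ and $c_2n^{-2/3}$. -/

import Mathlib

open MeasureTheory ProbabilityTheory
open scoped NNReal ENNReal

noncomputable section

namespace HorizonFilter

/-! ### Horizon images -/

/-- Contours that are `k` times differentiable on `ℝ` and whose `k`-th derivative is Hölder of
exponent `α - k` with constant `C`. -/
def HolderClass (k : ℕ) (α C : ℝ) : Set (ℝ → ℝ) :=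
  {h | (∀ l < k, Differentiable ℝ (iteratedDeriv l h)) ∧
    ∀ t t' : ℝ, |iteratedDeriv k h t - iteratedDeriv k h t'| ≤ C * |t - t'| ^ (α - k)}

/-- The image `f_h(t₁, t₂) = 1` if `t₂ < h(t₁)`, and `0` otherwise.
Only its values on the unit square are ever used. -/
def horizonImage (h : ℝ → ℝ) : ℝ × ℝ → ℝ :=
  Set.indicator {t : ℝ × ℝ | t.2 < h t.1} (fun _ => 1)

/-- The Horizon class `H^α(C)`: contours in `Hölder^α(C) ∩ Hölder^1(1)`. The function `ord`
gives the order of the derivative that occurs in the definition of the Hölder class of a given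
smoothness. -/
def horizonClass (ord : ℝ → ℕ) (α C : ℝ) : Set (ℝ × ℝ → ℝ) :=
  {f | ∃ h : ℝ → ℝ, h ∈ HolderClass (ord α) α C ∩ HolderClass (ord 1) 1 1 ∧ f = horizonImage h}

/-! ### Pixels

The pixels of an `n × n` image are indexed by `ZMod n × ZMod n`, with representatives
`0, …, n - 1`; shifting an index in `ZMod n` is the periodic extension of the image. -/

/-- `Pixel(i,j) = [i/n, (i+1)/n) × [j/n, (j+1)/n)`. -/
def pixel (n : ℕ) (i j : ZMod n) : Set (ℝ × ℝ) :=
  Set.Ico ((i.val : ℝ) / n) (((i.val : ℝ) + 1) / n) ×ˢ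
    Set.Ico ((j.val : ℝ) / n) (((j.val : ℝ) + 1) / n)

/-- The pixel averages `x_{i,j}` of `f`. -/
def pixelAverage (n : ℕ) (f : ℝ × ℝ → ℝ) (i j : ZMod n) : ℝ :=
  ⨍ t in pixel n i j, f t

/-! ### Linear convolution filters -/

/-- The filter output `∑ₘ ∑ₗ g_{m,l} y_{i-m,j-l}`, with `y` extended periodically. -/
def linearFilter (g : ℤ → ℤ → ℝ) {n : ℕ} (y : ZMod n → ZMod n → ℝ) (i j : ZMod n) : ℝ :=
  ∑' p : ℤ × ℤ, g p.1 p.2 * y (i - (p.1 : ZMod n)) (j - (p.2 : ZMod n))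

/-- The two-dimensional Fourier transform `Ĝ(ω₁, ω₂)` of the impulse response `g`. -/
def fourierTransform (g : ℤ → ℤ → ℝ) (ω₁ ω₂ : ℝ) : ℂ :=
  ∑' p : ℤ × ℤ, (g p.1 p.2 : ℂ) *
    Complex.exp (-Complex.I * ((p.1 : ℂ) * (ω₁ : ℂ) + (p.2 : ℂ) * (ω₂ : ℂ)))

/-- The Euclidean norm of the gradient of `Ĝ` at `(ω₁, ω₂)`. -/
def gradNorm (g : ℤ → ℤ → ℝ) (ω₁ ω₂ : ℝ) : ℝ :=
  Real.sqrt (‖deriv (fun t => fourierTransform g t ω₂) ω₁‖ ^ 2 +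
    ‖deriv (fun t => fourierTransform g ω₁ t) ω₂‖ ^ 2)

/-- The filters under consideration: real impulse responses, absolutely summable with total
weight one, symmetric, isotropic, and with a Fourier transform of bounded gradient. -/
structure IsAdmissible (g : ℤ → ℤ → ℝ) : Prop where
  hasSum_one : HasSum (fun p : ℤ × ℤ => g p.1 p.2) 1
  symm_fst : ∀ i j, g (-i) j = g i j
  symm_snd : ∀ i j, g i (-j) = g i j
  isotropic : ∃ F : ℝ → ℂ, ∀ ω₁ ω₂ : ℝ,
    -Real.pi < ω₁ → ω₁ ≤ Real.pi → -Real.pi < ω₂ → ω₂ ≤ Real.pi →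
      fourierTransform g ω₁ ω₂ = F (Real.sqrt (ω₁ ^ 2 + ω₂ ^ 2))
  differentiable : Differentiable ℝ (fun ω : ℝ × ℝ => fourierTransform g ω.1 ω.2)
  bounded_grad : ∃ D : ℝ, ∀ ω₁ ω₂ : ℝ, gradNorm g ω₁ ω₂ ≤ D

/-! ### Risk -/

/-- The law of the noise: independent `N(0, σ²)` variables, one for each pixel. -/
def noiseLaw (σ : ℝ≥0) (n : ℕ) [NeZero n] : Measure (ZMod n × ZMod n → ℝ) :=
  Measure.pi (fun _ => gaussianReal 0 (σ ^ 2))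

/-- The risk `E (n⁻² ∑ᵢ ∑ⱼ (x_{i,j} - f̂_{i,j})²)` of the linear filter `g` at the image `f`, where
the data are `y_{i,j} = x_{i,j} + z_{i,j}`. -/
def risk (σ : ℝ≥0) (n : ℕ) [NeZero n] (f : ℝ × ℝ → ℝ) (g : ℤ → ℤ → ℝ) : ℝ≥0∞ :=
  ∫⁻ z, ENNReal.ofReal (1 / (n : ℝ) ^ 2 * ∑ i : ZMod n, ∑ j : ZMod n,
    (pixelAverage n f i j -
      linearFilter g (fun a b => pixelAverage n f a b + z (a, b)) i j) ^ 2) ∂(noiseLaw σ n)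

/-- The best worst-case risk of the admissible linear filters over the Horizon class. -/
def minimaxRisk (ord : ℝ → ℕ) (α C : ℝ) (σ : ℝ≥0) (n : ℕ) [NeZero n] : ℝ≥0∞ :=
  ⨅ (g : ℤ → ℤ → ℝ) (_ : IsAdmissible g), ⨆ f ∈ horizonClass ord α C, risk σ n f g

end HorizonFilter

end

/-!
On the torus a convolution filter acts diagonally on Fourier coefficients, so its risk is the sum
over the frequencies `k` of `|1 - Ĝ k|² |x̂ k|² / n⁴ + σ² |Ĝ k|² / n²`.

Upper bound: the contours are Lipschitz, so a shift by one pixel changes a horizon image by `O(n)`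
in `ℓ¹`, which limits the power of the image outside a ball of radius `ρ` to `O(1 / ρ)`. A smooth
radial low-pass filter of that radius has variance `O(ρ² / n²)`, and `ρ ≍ n ^ (2 / 3)` balances the
two.

Lower bound: the power of a straight edge is spread along the normal direction of the edge, with
`≍ 1 / M²` at a frequency of modulus `≍ M`. Each of the `≍ M²` frequencies of that size in a fixed
cone is met by one of `≍ M` slopes. The filter does not depend on the slope, so at each of these
frequencies it either lets the noise pass for all slopes or suppresses an edge. Averaged over the
slopes, the risk is at least of order `M * min (1 / M²) (M / n²)`, and `M ≍ n ^ (2 / 3)`.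
-/

noncomputable section

namespace HorizonFilter

open scoped FourierTransform

/-! ### The Fourier transform on the discrete torus -/

/-- The character `a ↦ exp (2πi (k₁ a₁ + k₂ a₂) / n)` of the discrete torus with frequency `k`. -/
def torusChar {n : ℕ} [NeZero n] (k : ZMod n × ZMod n) : AddChar (ZMod n × ZMod n) ℂ where
  toFun a := ZMod.stdAddChar (k.1 * a.1 + k.2 * a.2)
  map_zero_eq_one' := by simp
  map_add_eq_mul' a b := by
    rw [← AddChar.map_add_eq_mul, Prod.fst_add, Prod.snd_add]
    congr 1
    ring

/-- The unnormalized Fourier transform of a real function on the discrete torus, to be applied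
both to images and to the weights of a filter. -/
def torusDFT {n : ℕ} [NeZero n] (u : ZMod n × ZMod n → ℝ) (k : ZMod n × ZMod n) : ℂ :=
  ∑ a, (u a : ℂ) * torusChar k (-a)

section Torus

variable {n : ℕ} [NeZero n]

theorem torusChar_apply (k a : ZMod n × ZMod n) :
    torusChar k a = ZMod.stdAddChar (k.1 * a.1 + k.2 * a.2) :=
  rfl

theorem torusChar_comm (k a : ZMod n × ZMod n) : torusChar k a = torusChar a k := by
  simp only [torusChar_apply, mul_comm]

theorem torusChar_eq_zero_iff {k : ZMod n × ZMod n} : torusChar k = 0 ↔ k = 0 := by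
  refine ⟨fun h => ?_, fun h => DFunLike.ext _ _ fun a => by simp [h, torusChar_apply]⟩
  have h₁ := DFunLike.congr_fun h (1, 0)
  have h₂ := DFunLike.congr_fun h (0, 1)
  simp only [torusChar_apply, mul_one, mul_zero, add_zero, zero_add, AddChar.zero_apply] at h₁ h₂
  rw [← AddChar.map_zero_eq_one (ZMod.stdAddChar (N := n))] at h₁ h₂
  exact Prod.ext (ZMod.injective_stdAddChar h₁) (ZMod.injective_stdAddChar h₂)

theorem sum_torusChar_apply (a : ZMod n × ZMod n) :
    ∑ k, torusChar k a = if a = 0 then (n : ℂ) ^ 2 else 0 := by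
  classical
  simp_rw [fun k => torusChar_comm k a, AddChar.sum_eq_ite, torusChar_eq_zero_iff]
  simp [sq]

theorem torusDFT_sub (u v : ZMod n × ZMod n → ℝ) (k : ZMod n × ZMod n) :
    torusDFT (fun a => u a - v a) k = torusDFT u k - torusDFT v k := by
  simp only [torusDFT, Complex.ofReal_sub, sub_mul, Finset.sum_sub_distrib]

theorem torusDFT_translate (u : ZMod n × ZMod n → ℝ) (c k : ZMod n × ZMod n) :
    torusDFT (fun a => u (a - c)) k = torusChar k (-c) * torusDFT u k := by
  simp only [torusDFT]
  rw [← Equiv.sum_comp (Equiv.addRight c), Finset.mul_sum]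
  refine Finset.sum_congr rfl fun a _ => ?_
  rw [Equiv.coe_addRight, add_sub_cancel_right, neg_add_rev, AddChar.map_add_eq_mul]
  ring

theorem torusDFT_sub_translate (u : ZMod n × ZMod n → ℝ) (c k : ZMod n × ZMod n) :
    torusDFT (fun a => u a - u (a - c)) k = (1 - torusChar k (-c)) * torusDFT u k := by
  rw [torusDFT_sub, torusDFT_translate, one_sub_mul]

theorem torusDFT_convolution (w u : ZMod n × ZMod n → ℝ) (k : ZMod n × ZMod n) :
    torusDFT (fun a => ∑ c, w c * u (a - c)) k = torusDFT w k * torusDFT u k := by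
  calc torusDFT (fun a => ∑ c, w c * u (a - c)) k
      = ∑ c, (w c : ℂ) * torusDFT (fun a => u (a - c)) k := by
        simp only [torusDFT, Complex.ofReal_sum, Complex.ofReal_mul, Finset.sum_mul,
          Finset.mul_sum, mul_assoc]
        exact Finset.sum_comm
    _ = torusDFT w k * torusDFT u k := by
        simp_rw [torusDFT_translate, ← mul_assoc, ← Finset.sum_mul]
        rfl

theorem sum_norm_sq_torusDFT (u : ZMod n × ZMod n → ℝ) :
    ∑ k, ‖torusDFT u k‖ ^ 2 = (n : ℝ) ^ 2 * ∑ a, u a ^ 2 := by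
  have hconj (k : ZMod n × ZMod n) :
      (starRingEnd ℂ) (torusDFT u k) = ∑ b, (u b : ℂ) * torusChar k b := by
    simp only [torusDFT, map_sum, map_mul, Complex.conj_ofReal, AddChar.map_neg_eq_conj,
      Complex.conj_conj]
  have hpair (a b : ZMod n × ZMod n) :
      ∑ k, (u a : ℂ) * torusChar k (-a) * (u b * torusChar k b) =
        if b = a then (n : ℂ) ^ 2 * u a ^ 2 else 0 := by
    have hterm (k : ZMod n × ZMod n) : (u a : ℂ) * torusChar k (-a) * (u b * torusChar k b) =
        u a * u b * torusChar k (b - a) := by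
      rw [sub_eq_add_neg, AddChar.map_add_eq_mul]
      ring
    simp_rw [hterm, ← Finset.mul_sum, sum_torusChar_apply, sub_eq_zero]
    split_ifs with h
    · rw [h]
      ring
    · rw [mul_zero]
  have hsum : ∑ k, (‖torusDFT u k‖ : ℂ) ^ 2 = (n : ℂ) ^ 2 * ∑ a, (u a : ℂ) ^ 2 := by
    simp_rw [← Complex.mul_conj', hconj]
    simp only [torusDFT, Finset.sum_mul_sum]
    rw [Finset.sum_comm, Finset.mul_sum]
    refine Finset.sum_congr rfl fun a _ => ?_
    rw [Finset.sum_comm]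
    simp_rw [hpair, Finset.sum_ite_eq', Finset.mem_univ, if_true]
  exact_mod_cast hsum

end Torus

/-! ### The risk in the frequency domain -/

theorem integral_sub_linear_gaussian_sq {ι : Type*} [Fintype ι] (v : ℝ≥0) (b : ℝ) (c : ι → ℝ) :
    Integrable (fun z : ι → ℝ => (b - ∑ a, c a * z a) ^ 2)
        (Measure.pi fun _ : ι => gaussianReal 0 v) ∧
      ∫ z, (b - ∑ a, c a * z a) ^ 2 ∂(Measure.pi fun _ : ι => gaussianReal 0 v) =
        b ^ 2 + v * ∑ a, c a ^ 2 := by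
  set μ : Measure (ι → ℝ) := Measure.pi fun _ : ι => gaussianReal 0 v
  have hid : MemLp (fun x : ℝ => x) 2 (gaussianReal 0 v) := memLp_id_gaussianReal' 2 (by simp)
  have hcoord (a : ι) : MemLp (fun z : ι → ℝ => c a * z a) 2 μ :=
    (hid.comp_measurePreserving (measurePreserving_eval _ a)).const_mul (c a)
  have hsum : MemLp (fun z : ι → ℝ => ∑ a, c a * z a) 2 μ := memLp_finsetSum _ fun a _ => hcoord a
  have hY : MemLp (fun z : ι → ℝ => b - ∑ a, c a * z a) 2 μ := (memLp_const b).sub hsum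
  have hmean_coord (a : ι) : ∫ z : ι → ℝ, z a ∂μ = 0 :=
    (integral_eval (μ := fun _ : ι => gaussianReal 0 v)).trans integral_id_gaussianReal
  have hmean : ∫ z, (b - ∑ a, c a * z a) ∂μ = b := by
    rw [integral_sub (integrable_const b) (hsum.integrable one_le_two),
      integral_finsetSum _ fun a _ => (hcoord a).integrable one_le_two]
    simp [integral_const_mul, hmean_coord]
  have hvar : variance (fun z : ι → ℝ => b - ∑ a, c a * z a) μ = v * ∑ a, c a ^ 2 := by
    have h := variance_sum_pi (μ := fun _ : ι => gaussianReal 0 v) (X := fun a x => c a * x)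
      fun a => hid.const_mul (c a)
    have hfun : (∑ a, fun z : ι → ℝ => c a * z a) = fun z => ∑ a, c a * z a := by
      ext z
      simp only [Finset.sum_apply]
    rw [variance_const_sub hsum.aestronglyMeasurable, ← hfun, h, Finset.mul_sum]
    refine Finset.sum_congr rfl fun a _ => ?_
    rw [variance_const_mul, variance_fun_id_gaussianReal, mul_comm]
  refine ⟨hY.integrable_sq, ?_⟩
  have h := variance_eq_sub hY
  simp only [hvar, hmean, Pi.pow_apply] at h
  linarith

theorem tsum_mul_comp_eq_sum {P ι 𝕜 : Type*} [Fintype ι] [DecidableEq ι] [RCLike 𝕜]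
    {G : P → 𝕜} (hG : Summable G) (r : P → ι) (u : ι → 𝕜) :
    ∑' p, G p * u (r p) = ∑ c, (∑' p, if r p = c then G p else 0) * u c := by
  have hs (c : ι) : Summable fun p => if r p = c then G p else 0 :=
    (hG.indicator {p | r p = c}).congr fun p => by simp [Set.indicator_apply]
  simp_rw [← tsum_mul_right]
  rw [← Summable.tsum_finsetSum fun c _ => (hs c).mul_right (u c)]
  exact tsum_congr fun p => by simp

/-- Reduction of an integer index modulo `n`. -/
def reduce (n : ℕ) (p : ℤ × ℤ) : ZMod n × ZMod n := (p.1, p.2)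

/-- The weights on the discrete torus of the filter with impulse response `g`: on images of period
`n`, only the sums of `g` over residue classes matter. -/
def periodize (g : ℤ → ℤ → ℝ) (n : ℕ) (c : ZMod n × ZMod n) : ℝ :=
  ∑' p : ℤ × ℤ, if reduce n p = c then g p.1 p.2 else 0

/-- The image of pixel averages as a function on the discrete torus. -/
def pixelImage (n : ℕ) (f : ℝ × ℝ → ℝ) (a : ZMod n × ZMod n) : ℝ := pixelAverage n f a.1 a.2

section Risk

variable {g : ℤ → ℤ → ℝ} (hg : Summable fun p : ℤ × ℤ => g p.1 p.2) {n : ℕ} [NeZero n]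
include hg

theorem linearFilter_eq_sum (y : ZMod n → ZMod n → ℝ) (i j : ZMod n) :
    linearFilter g y i j = ∑ c, periodize g n c * y (i - c.1) (j - c.2) :=
  tsum_mul_comp_eq_sum hg (reduce n) fun c => y (i - c.1) (j - c.2)

theorem torusDFT_periodize (k : ZMod n × ZMod n) :
    torusDFT (periodize g n) k = ∑' p : ℤ × ℤ, (g p.1 p.2 : ℂ) * torusChar k (-reduce n p) := by
  have hg' : Summable fun p : ℤ × ℤ => (g p.1 p.2 : ℂ) := Complex.summable_ofReal.2 hg
  rw [tsum_mul_comp_eq_sum hg' (reduce n) fun c => torusChar k (-c)]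
  refine Finset.sum_congr rfl fun c _ => ?_
  simp_rw [periodize, Complex.ofReal_tsum, apply_ite Complex.ofReal, Complex.ofReal_zero]

theorem risk_eq_bias_add_variance (σ : ℝ≥0) (f : ℝ × ℝ → ℝ) :
    risk σ n f g = ENNReal.ofReal (((n : ℝ) ^ 2)⁻¹ *
      ∑ a, (pixelImage n f a - ∑ c, periodize g n c * pixelImage n f (a - c)) ^ 2 +
        (σ : ℝ) ^ 2 * ∑ c, periodize g n c ^ 2) := by
  set b : ZMod n × ZMod n → ℝ :=
    fun a => pixelImage n f a - ∑ c, periodize g n c * pixelImage n f (a - c)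
  have herr (z : ZMod n × ZMod n → ℝ) (i j : ZMod n) : pixelAverage n f i j -
      linearFilter g (fun a b => pixelAverage n f a b + z (a, b)) i j =
      b (i, j) - ∑ a, periodize g n ((i, j) - a) * z a := by
    have hnoise : ∑ a, periodize g n ((i, j) - a) * z a =
        ∑ c, periodize g n c * z ((i, j) - c) := by
      simp [← Equiv.sum_comp (Equiv.subLeft (i, j)) fun c => periodize g n c * z ((i, j) - c)]
    rw [linearFilter_eq_sum hg, hnoise]
    simp_rw [mul_add, Finset.sum_add_distrib, ← sub_sub]
    rfl
  have hint (a : ZMod n × ZMod n) :=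
    integral_sub_linear_gaussian_sq (σ ^ 2) (b a) fun c => periodize g n (a - c)
  have hvar (a : ZMod n × ZMod n) :
      ∑ c, periodize g n (a - c) ^ 2 = ∑ c, periodize g n c ^ 2 :=
    Equiv.sum_comp (Equiv.subLeft a) fun c => periodize g n c ^ 2
  simp_rw [risk, noiseLaw, herr, ← Fintype.sum_prod_type']
  rw [← ofReal_integral_eq_lintegral_ofReal
      ((integrable_finsetSum _ fun a _ => (hint a).1).const_mul _)
      (Filter.Eventually.of_forall fun z => by positivity),
    integral_const_mul, integral_finsetSum _ fun a _ => (hint a).1]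
  simp_rw [(hint _).2, hvar, Finset.sum_add_distrib, Finset.sum_const, Finset.card_univ,
    Fintype.card_prod, ZMod.card, nsmul_eq_mul]
  congr 1
  have hn : (n : ℝ) ≠ 0 := NeZero.ne _
  push_cast
  field_simp
  rfl

theorem risk_eq_sum_frequencies (σ : ℝ≥0) (f : ℝ × ℝ → ℝ) :
    risk σ n f g = ENNReal.ofReal (∑ k, (
      ‖1 - torusDFT (periodize g n) k‖ ^ 2 * (‖torusDFT (pixelImage n f) k‖ ^ 2 / (n : ℝ) ^ 4) +
        (σ : ℝ) ^ 2 / (n : ℝ) ^ 2 * ‖torusDFT (periodize g n) k‖ ^ 2)) := by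
  have hn : (n : ℝ) ≠ 0 := NeZero.ne _
  have hbias := sum_norm_sq_torusDFT
    fun a => pixelImage n f a - ∑ c, periodize g n c * pixelImage n f (a - c)
  simp_rw [torusDFT_sub, torusDFT_convolution, ← one_sub_mul, norm_mul, mul_pow] at hbias
  rw [risk_eq_bias_add_variance hg]
  simp_rw [Finset.sum_add_distrib, ← Finset.mul_sum, ← mul_div_assoc, ← Finset.sum_div,
    hbias, sum_norm_sq_torusDFT]
  congr 1
  field_simp

end Risk

/-! ### Fourier transforms of filters -/

/-- The pure wave `exp (-i (p₁ ω₁ + p₂ ω₂))` by which the Fourier transform of a filter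
integrates its weight at `p`. -/
def planeWave (p : ℤ × ℤ) (ω : ℝ × ℝ) : ℂ :=
  Complex.exp (-Complex.I * ((p.1 : ℂ) * (ω.1 : ℂ) + (p.2 : ℂ) * (ω.2 : ℂ)))

theorem planeWave_eq (p : ℤ × ℤ) (ω : ℝ × ℝ) :
    planeWave p ω = Complex.exp (Complex.I * ((-(p.1 * ω.1 + p.2 * ω.2) : ℝ) : ℂ)) := by
  rw [planeWave]
  push_cast
  ring_nf

theorem norm_planeWave (p : ℤ × ℤ) (ω : ℝ × ℝ) : ‖planeWave p ω‖ = 1 := by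
  rw [planeWave_eq, Complex.norm_exp_I_mul_ofReal]

theorem norm_planeWave_sub_le (p : ℤ × ℤ) (ω ω' : ℝ × ℝ) :
    ‖planeWave p ω - planeWave p ω'‖ ≤ 2 * ‖p‖ * ‖ω - ω'‖ := by
  have hfactor : planeWave p ω - planeWave p ω' =
      planeWave p ω' * (planeWave p (ω - ω') - 1) := by
    rw [mul_sub_one, planeWave, planeWave, planeWave, ← Complex.exp_add]
    congr 2
    push_cast [Prod.fst_sub, Prod.snd_sub]
    ring
  have hfst : |(p.1 : ℝ)| * |(ω - ω').1| ≤ ‖p‖ * ‖ω - ω'‖ := by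
    gcongr
    · exact (Int.norm_eq_abs p.1).ge.trans (norm_fst_le p)
    · exact norm_fst_le (ω - ω')
  have hsnd : |(p.2 : ℝ)| * |(ω - ω').2| ≤ ‖p‖ * ‖ω - ω'‖ := by
    gcongr
    · exact (Int.norm_eq_abs p.2).ge.trans (norm_snd_le p)
    · exact norm_snd_le (ω - ω')
  rw [hfactor, norm_mul, norm_planeWave, one_mul, planeWave_eq]
  refine Real.norm_exp_I_mul_ofReal_sub_one_le.trans ?_
  rw [norm_neg, Real.norm_eq_abs]
  refine (abs_add_le _ _).trans ?_
  rw [abs_mul, abs_mul]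
  linarith

section Moment

variable {g : ℤ → ℤ → ℝ}

theorem summable_of_summable_norm_mul (hg : Summable fun p : ℤ × ℤ => ‖p‖ * |g p.1 p.2|) :
    Summable fun p : ℤ × ℤ => g p.1 p.2 := by
  refine hg.of_norm_bounded_eventually ?_
  filter_upwards [(Set.finite_singleton (0 : ℤ × ℤ)).compl_mem_cofinite] with p hp
  have hp1 : 1 ≤ ‖p‖ := by
    rcases p with ⟨m, l⟩
    rw [Prod.norm_mk, Int.norm_eq_abs, Int.norm_eq_abs, le_max_iff]
    norm_cast
    simp only [Set.mem_compl_iff, Set.mem_singleton_iff, Prod.mk_eq_zero] at hp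
    grind
  exact le_mul_of_one_le_left (abs_nonneg _) hp1

theorem summable_mul_planeWave (hg : Summable fun p : ℤ × ℤ => g p.1 p.2) (ω : ℝ × ℝ) :
    Summable fun p : ℤ × ℤ => (g p.1 p.2 : ℂ) * planeWave p ω :=
  .of_norm <| hg.abs.congr fun p => by
    rw [norm_mul, norm_planeWave, mul_one, Complex.norm_real, Real.norm_eq_abs]

theorem norm_mul_planeWave_sub_le (p : ℤ × ℤ) (ω ω' : ℝ × ℝ) :
    ‖(g p.1 p.2 : ℂ) * planeWave p ω - g p.1 p.2 * planeWave p ω'‖ ≤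
      2 * (‖p‖ * |g p.1 p.2|) * ‖ω - ω'‖ := by
  rw [← mul_sub, norm_mul, Complex.norm_real, Real.norm_eq_abs]
  refine (mul_le_mul_of_nonneg_left (norm_planeWave_sub_le p ω ω') (abs_nonneg _)).trans_eq ?_
  ring

variable (hg : Summable fun p : ℤ × ℤ => ‖p‖ * |g p.1 p.2|)
include hg

theorem norm_fourierTransform_sub_le (ω ω' : ℝ × ℝ) :
    ‖fourierTransform g ω.1 ω.2 - fourierTransform g ω'.1 ω'.2‖ ≤
      (∑' p : ℤ × ℤ, 2 * (‖p‖ * |g p.1 p.2|)) * ‖ω - ω'‖ := by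
  have hs := summable_mul_planeWave (summable_of_summable_norm_mul hg)
  have hsub : fourierTransform g ω.1 ω.2 - fourierTransform g ω'.1 ω'.2 =
      ∑' p : ℤ × ℤ, ((g p.1 p.2 : ℂ) * planeWave p ω - g p.1 p.2 * planeWave p ω') :=
    ((hs ω).tsum_sub (hs ω')).symm
  rw [hsub, ← tsum_mul_right]
  exact tsum_of_norm_bounded ((hg.mul_left 2).mul_right _).hasSum fun p =>
    norm_mul_planeWave_sub_le p ω ω'

theorem differentiable_fourierTransform :
    Differentiable ℝ fun ω : ℝ × ℝ => fourierTransform g ω.1 ω.2 := by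
  have hd (p : ℤ × ℤ) : Differentiable ℝ fun ω => (g p.1 p.2 : ℂ) * planeWave p ω := by
    have h₁ : Differentiable ℝ fun ω : ℝ × ℝ => (ω.1 : ℂ) :=
      Complex.ofRealCLM.differentiable.comp differentiable_fst
    have h₂ : Differentiable ℝ fun ω : ℝ × ℝ => (ω.2 : ℂ) :=
      Complex.ofRealCLM.differentiable.comp differentiable_snd
    exact (((h₁.const_mul _).add (h₂.const_mul _)).const_mul _).cexp.const_mul _
  exact differentiable_tsum (hg.mul_left 2) (fun p ω => (hd p ω).hasFDerivAt) fun p ω =>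
    norm_fderiv_le_of_lip' ℝ (by positivity)
      (.of_forall fun ω' => norm_mul_planeWave_sub_le p ω' ω)

theorem exists_gradNorm_le : ∃ D : ℝ, ∀ ω₁ ω₂ : ℝ, gradNorm g ω₁ ω₂ ≤ D := by
  obtain ⟨D, hD, hlip⟩ : ∃ D : ℝ, 0 ≤ D ∧ ∀ ω ω' : ℝ × ℝ,
      ‖fourierTransform g ω.1 ω.2 - fourierTransform g ω'.1 ω'.2‖ ≤ D * ‖ω - ω'‖ :=
    ⟨_, tsum_nonneg fun _ => by positivity, norm_fourierTransform_sub_le hg⟩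
  refine ⟨Real.sqrt (D ^ 2 + D ^ 2), fun ω₁ ω₂ => Real.sqrt_le_sqrt (add_le_add ?_ ?_)⟩
  · refine pow_le_pow_left₀ (norm_nonneg _)
      (norm_deriv_le_of_lip' hD (.of_forall fun t => ?_)) 2
    simpa [Prod.norm_def] using hlip (t, ω₂) (ω₁, ω₂)
  · refine pow_le_pow_left₀ (norm_nonneg _)
      (norm_deriv_le_of_lip' hD (.of_forall fun t => ?_)) 2
    simpa [Prod.norm_def] using hlip (ω₁, t) (ω₁, ω₂)

end Moment

theorem torusDFT_periodize_eq_fourierTransform {g : ℤ → ℤ → ℝ}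
    (hg : Summable fun p : ℤ × ℤ => g p.1 p.2) {n : ℕ} [NeZero n] (k : ZMod n × ZMod n) :
    torusDFT (periodize g n) k =
      fourierTransform g (2 * Real.pi * k.1.valMinAbs / n) (2 * Real.pi * k.2.valMinAbs / n) := by
  rw [torusDFT_periodize hg, fourierTransform]
  refine tsum_congr fun p => ?_
  have hlift : k.1 * (-reduce n p).1 + k.2 * (-reduce n p).2 =
      ((-(p.1 * k.1.valMinAbs + p.2 * k.2.valMinAbs) : ℤ) : ZMod n) := by
    push_cast [reduce, ZMod.coe_valMinAbs]
    simp only [Prod.neg_mk]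
    ring
  rw [torusChar_apply, hlift, ZMod.stdAddChar_coe]
  congr 2
  push_cast
  ring

/-! ### Low-pass filters -/

theorem fourier_radial {V E : Type*} [NormedAddCommGroup V] [InnerProductSpace ℝ V]
    [FiniteDimensional ℝ V] [MeasurableSpace V] [BorelSpace V] [NormedAddCommGroup E]
    [NormedSpace ℂ E] (φ : ℝ → E) {w w' : V} (h : ‖w‖ = ‖w'‖) :
    𝓕 (fun v : V => φ ‖v‖) w = 𝓕 (fun v : V => φ ‖v‖) w' := by
  set A : V ≃ₗᵢ[ℝ] V := (ℝ ∙ (w - w'))ᗮ.reflection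
  have hA : (fun v : V => φ ‖v‖) ∘ A = fun v => φ ‖v‖ := funext fun v => by
    rw [Function.comp_apply, A.norm_map]
  rw [← Submodule.reflection_sub h, ← Real.fourier_comp_linearIsometry A, hA]

theorem mFourierCoeff_eq_fourier {d E : Type*} [Fintype d] [NormedAddCommGroup E]
    [NormedSpace ℂ E] {F : UnitAddTorus d → E} {f : EuclideanSpace ℝ d → E}
    (hF : ∀ x : d → ℝ, (∀ i, |x i| ≤ 1 / 2) → F (fun i => x i) = f (WithLp.toLp 2 x))
    (hf : ∀ x : d → ℝ, (∃ i, 1 / 2 ≤ |x i|) → f (WithLp.toLp 2 x) = 0) (p : d → ℤ) :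
    UnitAddTorus.mFourierCoeff F p = 𝓕 f (WithLp.toLp 2 fun i => (p i : ℝ)) := by
  set cube := {x : d → ℝ | ∀ i, x i ∈ Set.Ioc (-(1 / 2) : ℝ) (-(1 / 2) + 1)}
  have hmem {x : d → ℝ} (hx : x ∈ cube) (i : d) : |x i| ≤ 1 / 2 :=
    abs_le.2 ⟨(hx i).1.le, (hx i).2.trans_eq (by norm_num)⟩
  have hcube : MeasurableSet cube := by
    simp only [cube, Set.ofPred_forall]
    exact .iInter fun i => measurableSet_Ioc.preimage (measurable_pi_apply i)
  set w : EuclideanSpace ℝ d := WithLp.toLp 2 fun i => (p i : ℝ)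
  set G : EuclideanSpace ℝ d → E :=
    fun v => Complex.exp (↑(-2 * Real.pi * inner ℝ v w) * Complex.I) • f v
  have hterm (x : d → ℝ) (hx : x ∈ cube) :
      UnitAddTorus.mFourier (-p) (fun i => x i) • F (fun i => x i) = G (WithLp.toLp 2 x) := by
    simp only [hF x (hmem hx), G, w, UnitAddTorus.mFourier, ContinuousMap.coe_mk,
      fourier_coe_apply, ← Complex.exp_sum, PiLp.inner_apply, Pi.neg_apply]
    congr 2
    push_cast [Finset.mul_sum, Finset.sum_mul]
    refine Finset.sum_congr rfl fun i _ => ?_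
    simp
    ring
  have hzero (x : d → ℝ) (hx : x ∉ cube) : G (WithLp.toLp 2 x) = 0 := by
    obtain ⟨i, hi⟩ : ∃ i, x i ∉ Set.Ioc (-(1 / 2) : ℝ) (-(1 / 2) + 1) := not_forall.1 hx
    have hi' : 1 / 2 ≤ |x i| := by
      by_contra! h
      exact hi ⟨(abs_lt.1 h).1, (abs_lt.1 h).2.le.trans_eq (by norm_num)⟩
    simp only [G, hf x ⟨i, hi'⟩, smul_zero]
  calc UnitAddTorus.mFourierCoeff F p
      = ∫ x in cube, UnitAddTorus.mFourier (-p) (fun i => x i) • F (fun i => x i) :=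
        UnitAddTorus.mFourierCoeff_eq_integral F p _
    _ = ∫ x in cube, G (WithLp.toLp 2 x) := setIntegral_congr_fun hcube hterm
    _ = ∫ x, G (WithLp.toLp 2 x) := setIntegral_eq_integral_of_forall_compl_eq_zero hzero
    _ = ∫ v, G v := (PiLp.volume_preserving_toLp d).integral_comp
        (MeasurableEquiv.toLp 2 (d → ℝ)).measurableEmbedding G
    _ = 𝓕 f w := (Real.fourier_eq' f w).symm

open scoped ContDiff in
theorem exists_norm_fourier_le {V : Type*} [NormedAddCommGroup V] [InnerProductSpace ℝ V]
    [FiniteDimensional ℝ V] [MeasurableSpace V] [BorelSpace V] {f : V → ℂ} (hf : ContDiff ℝ ∞ f)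
    (hs : HasCompactSupport f) (k : ℕ) : ∃ A : ℝ, ∀ w, ‖w‖ ^ k * ‖𝓕 f w‖ ≤ A := by
  obtain ⟨A, -, hA⟩ := (𝓕 (hs.toSchwartzMap hf)).decay k 0
  simp only [norm_iteratedFDeriv_zero] at hA
  exact ⟨A, hA⟩

theorem conj_fourier_ofReal {V : Type*} [NormedAddCommGroup V] [InnerProductSpace ℝ V]
    [MeasurableSpace V] [BorelSpace V] [FiniteDimensional ℝ V] (φ : V → ℝ) (w : V) :
    (starRingEnd ℂ) (𝓕 (fun v => (φ v : ℂ)) w) = 𝓕 (fun v => (φ v : ℂ)) (-w) := by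
  rw [Real.fourier_eq', Real.fourier_eq', ← integral_conj]
  simp only [smul_eq_mul, map_mul, ← Complex.exp_conj, Complex.conj_ofReal, Complex.conj_I,
    inner_neg_right, mul_neg, Complex.ofReal_neg, neg_mul, map_neg]

/-- A smooth cutoff function: equal to one if `r ≤ 1.4 / N` and to zero if `r ≥ 1.8 / N`. -/
def cutoff (N : ℕ) (r : ℝ) : ℝ := Real.smoothTransition (3 - (N * r) ^ 2)

/-- The low-pass filter of bandwidth of order `1 / N`, whose Fourier transform is `cutoff N`
at `√(ω₁² + ω₂²) / 2π` on the square `|ωᵢ| ≤ π` and is periodic. -/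
def lowPass (N : ℕ) (m l : ℤ) : ℝ :=
  (𝓕 (fun v : EuclideanSpace ℝ (Fin 2) => (cutoff N ‖v‖ : ℂ)) !₂[(m : ℝ), (l : ℝ)]).re

theorem cutoff_eq_one {N : ℕ} {r : ℝ} (h : (N * r) ^ 2 ≤ 2) : cutoff N r = 1 :=
  Real.smoothTransition.one_of_one_le (by linarith)

theorem cutoff_eq_zero {N : ℕ} {r : ℝ} (h : 3 ≤ (N * r) ^ 2) : cutoff N r = 0 :=
  Real.smoothTransition.zero_of_nonpos (by linarith)

theorem cutoff_mem_Icc (N : ℕ) (r : ℝ) : cutoff N r ∈ Set.Icc 0 1 :=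
  ⟨Real.smoothTransition.nonneg _, Real.smoothTransition.le_one _⟩

theorem continuous_cutoff (N : ℕ) : Continuous (cutoff N) :=
  Real.smoothTransition.continuous.comp (by fun_prop)

open scoped ContDiff in
theorem contDiff_cutoff_norm {V : Type*} [NormedAddCommGroup V] [InnerProductSpace ℝ V] (N : ℕ) :
    ContDiff ℝ ∞ fun v : V => (cutoff N ‖v‖ : ℂ) := by
  refine Complex.ofRealCLM.contDiff.comp (Real.smoothTransition.contDiff.comp ?_)
  simp_rw [mul_pow]
  exact contDiff_const.sub (contDiff_const.mul (contDiff_norm_sq ℝ))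

theorem hasCompactSupport_cutoff_norm {V : Type*} [NormedAddCommGroup V] [ProperSpace V] {N : ℕ}
    (hN : 0 < N) : HasCompactSupport fun v : V => (cutoff N ‖v‖ : ℂ) := by
  refine HasCompactSupport.intro (isCompact_closedBall 0 2) fun v hv => ?_
  rw [mem_closedBall_zero_iff, not_le] at hv
  have hN' : (1 : ℝ) ≤ N := by exact_mod_cast hN
  have h2 : 2 ≤ N * ‖v‖ := by nlinarith
  rw [cutoff_eq_zero (by nlinarith), Complex.ofReal_zero]

theorem ofReal_lowPass (N : ℕ) (m l : ℤ) : (lowPass N m l : ℂ) =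
    𝓕 (fun v : EuclideanSpace ℝ (Fin 2) => (cutoff N ‖v‖ : ℂ)) !₂[(m : ℝ), (l : ℝ)] := by
  refine Complex.conj_eq_iff_re.1 ?_
  rw [conj_fourier_ofReal]
  exact fourier_radial (fun r => (cutoff N r : ℂ)) (norm_neg _)

theorem norm_toLp_fin_two (x : Fin 2 → ℝ) :
    ‖WithLp.toLp 2 x‖ = Real.sqrt (x 0 ^ 2 + x 1 ^ 2) := by
  simp only [EuclideanSpace.norm_eq, Fin.sum_univ_two, Real.norm_eq_abs, sq_abs]

theorem lowPass_eq_of_sq_add_sq_eq (N : ℕ) {m l m' l' : ℤ} (h : m ^ 2 + l ^ 2 = m' ^ 2 + l' ^ 2) :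
    lowPass N m l = lowPass N m' l' := by
  have h' : (m : ℝ) ^ 2 + (l : ℝ) ^ 2 = (m' : ℝ) ^ 2 + (l' : ℝ) ^ 2 := by exact_mod_cast h
  refine congrArg Complex.re (fourier_radial (fun r => (cutoff N r : ℂ)) ?_)
  simp only [norm_toLp_fin_two, Matrix.cons_val_zero, Matrix.cons_val_one, h']

theorem summable_norm_mul_lowPass {N : ℕ} (hN : 0 < N) :
    Summable fun p : ℤ × ℤ => ‖p‖ * |lowPass N p.1 p.2| := by
  obtain ⟨A, hA⟩ := exists_norm_fourier_le (contDiff_cutoff_norm N)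
    (hasCompactSupport_cutoff_norm (V := EuclideanSpace ℝ (Fin 2)) hN) 4
  have hsum : Summable fun p : ℤ × ℤ => A * ‖(finTwoArrowEquiv ℤ).symm p‖ ^ (-3 : ℝ) :=
    ((finTwoArrowEquiv ℤ).symm.summable_iff.2
      (EisensteinSeries.summable_one_div_norm_rpow (by norm_num))).mul_left A
  refine hsum.of_nonneg_of_le (fun _ => by positivity) fun p => ?_
  have hnorm : ‖(finTwoArrowEquiv ℤ).symm p‖ = ‖p‖ := by
    simp only [EisensteinSeries.norm_eq_max_natAbs, Prod.norm_def, Int.norm_eq_abs]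
    push_cast [Nat.cast_natAbs]
    rfl
  set w : EuclideanSpace ℝ (Fin 2) := !₂[(p.1 : ℝ), (p.2 : ℝ)]
  have hpw : ‖p‖ ≤ ‖w‖ := by
    rw [Prod.norm_def, Int.norm_eq_abs, Int.norm_eq_abs]
    exact max_le (PiLp.norm_apply_le w 0) (PiLp.norm_apply_le w 1)
  have hdecay : ‖p‖ ^ 4 * |lowPass N p.1 p.2| ≤ A :=
    calc ‖p‖ ^ 4 * |lowPass N p.1 p.2| ≤ ‖w‖ ^ 4 * ‖𝓕 (fun v : EuclideanSpace ℝ (Fin 2) =>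
            (cutoff N ‖v‖ : ℂ)) w‖ := by
          gcongr
          exact Complex.abs_re_le_norm _
      _ ≤ A := hA w
  rw [hnorm]
  rcases (norm_nonneg p).eq_or_lt with hp | hp
  · simp [← hp]
  · rw [Real.rpow_neg hp.le, ← div_eq_mul_inv, le_div_iff₀ (by positivity)]
    refine le_trans (le_of_eq ?_) hdecay
    norm_cast
    ring

/-- The periodic extension of the radial cutoff function from the square `|xᵢ| ≤ 1 / 2`. -/
def torusCutoff (N : ℕ) : C(UnitAddTorus (Fin 2), ℂ) where
  toFun t := cutoff N (Real.sqrt (‖t 0‖ ^ 2 + ‖t 1‖ ^ 2))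
  continuous_toFun :=
    Complex.continuous_ofReal.comp ((continuous_cutoff N).comp (by fun_prop))

theorem torusCutoff_coe (N : ℕ) {x : Fin 2 → ℝ} (hx : ∀ i, |x i| ≤ 1 / 2) :
    torusCutoff N (fun i => x i) = cutoff N (Real.sqrt (x 0 ^ 2 + x 1 ^ 2)) := by
  have hnorm (i : Fin 2) : ‖(x i : UnitAddCircle)‖ = |x i| :=
    (AddCircle.norm_coe_eq_abs_iff 1 one_ne_zero).2 (by simpa using hx i)
  simp only [torusCutoff, ContinuousMap.coe_mk, hnorm, sq_abs]

theorem mFourierCoeff_torusCutoff {N : ℕ} (hN : 4 ≤ N) (p : Fin 2 → ℤ) :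
    UnitAddTorus.mFourierCoeff (torusCutoff N) p = lowPass N (p 0) (p 1) := by
  rw [mFourierCoeff_eq_fourier (f := fun v => (cutoff N ‖v‖ : ℂ)), ofReal_lowPass]
  · congr 2
  · intro x hx
    rw [torusCutoff_coe N hx, norm_toLp_fin_two]
  · rintro x ⟨i, hi⟩
    have hN' : (4 : ℝ) ≤ N := by exact_mod_cast hN
    have hx : 1 / 2 ≤ ‖WithLp.toLp 2 x‖ := hi.trans (PiLp.norm_apply_le (WithLp.toLp 2 x) i)
    have h2 : 2 ≤ N * ‖WithLp.toLp 2 x‖ := by nlinarith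
    rw [cutoff_eq_zero (by nlinarith), Complex.ofReal_zero]

theorem planeWave_eq_mFourier (p : ℤ × ℤ) (ω : ℝ × ℝ) :
    planeWave p ω = UnitAddTorus.mFourier ((finTwoArrowEquiv ℤ).symm p)
      fun i => (![-ω.1 / (2 * Real.pi), -ω.2 / (2 * Real.pi)] i : ℝ) := by
  simp only [planeWave, UnitAddTorus.mFourier, ContinuousMap.coe_mk, Fin.prod_univ_two,
    fourier_coe_apply, ← Complex.exp_add, finTwoArrowEquiv_symm_apply, Matrix.cons_val_zero,
    Matrix.cons_val_one]
  congr 1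
  push_cast
  field_simp
  ring

theorem fourierTransform_lowPass {N : ℕ} (hN : 4 ≤ N) {ω₁ ω₂ : ℝ} (h₁ : |ω₁| ≤ Real.pi)
    (h₂ : |ω₂| ≤ Real.pi) :
    fourierTransform (lowPass N) ω₁ ω₂ =
      cutoff N (Real.sqrt (ω₁ ^ 2 + ω₂ ^ 2) / (2 * Real.pi)) := by
  set x : Fin 2 → ℝ := ![-ω₁ / (2 * Real.pi), -ω₂ / (2 * Real.pi)] with hx
  have hbound {ω : ℝ} (h : |ω| ≤ Real.pi) : |-ω / (2 * Real.pi)| ≤ 1 / 2 := by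
    rw [abs_div, abs_neg, abs_of_pos Real.two_pi_pos, div_le_iff₀ Real.two_pi_pos]
    linarith
  have hx_le (i : Fin 2) : |x i| ≤ 1 / 2 := by
    fin_cases i
    exacts [hbound h₁, hbound h₂]
  have hcoeff (p : ℤ × ℤ) : (lowPass N p.1 p.2 : ℂ) =
      UnitAddTorus.mFourierCoeff (torusCutoff N) ((finTwoArrowEquiv ℤ).symm p) := by
    simp only [mFourierCoeff_torusCutoff hN, finTwoArrowEquiv_symm_apply, Matrix.cons_val_zero,
      Matrix.cons_val_one]
  have hsum : Summable (UnitAddTorus.mFourierCoeff (torusCutoff N)) := by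
    rw [← (finTwoArrowEquiv ℤ).symm.summable_iff]
    exact (Complex.summable_ofReal.2 (summable_of_summable_norm_mul
      (summable_norm_mul_lowPass (by lia)))).congr hcoeff
  have hseries : fourierTransform (lowPass N) ω₁ ω₂ = ∑' q : Fin 2 → ℤ,
      UnitAddTorus.mFourierCoeff (torusCutoff N) q • UnitAddTorus.mFourier q fun i => x i := by
    rw [← (finTwoArrowEquiv ℤ).symm.tsum_eq]
    refine tsum_congr fun p => ?_
    rw [smul_eq_mul, ← hcoeff, ← planeWave_eq_mFourier p (ω₁, ω₂)]
    rfl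
  have hx_sq : x 0 ^ 2 + x 1 ^ 2 = (ω₁ ^ 2 + ω₂ ^ 2) / (2 * Real.pi) ^ 2 := by
    simp only [hx, Matrix.cons_val_zero, Matrix.cons_val_one, div_pow, neg_sq, add_div]
  rw [hseries, (UnitAddTorus.hasSum_mFourier_series_apply_of_summable hsum _).tsum_eq,
    torusCutoff_coe N hx_le, hx_sq, Real.sqrt_div' _ (by positivity),
    Real.sqrt_sq Real.two_pi_pos.le]

theorem isAdmissible_lowPass {N : ℕ} (hN : 4 ≤ N) : IsAdmissible (lowPass N) where
  hasSum_one := by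
    have hs := summable_of_summable_norm_mul (summable_norm_mul_lowPass (N := N) (by lia))
    have h0 := fourierTransform_lowPass hN (ω₁ := 0) (ω₂ := 0) (by simp [Real.pi_pos.le])
      (by simp [Real.pi_pos.le])
    have h1 : ∑' p : ℤ × ℤ, lowPass N p.1 p.2 = 1 := by
      simp only [fourierTransform, Complex.ofReal_zero, mul_zero, add_zero, Complex.exp_zero,
        mul_one, ← Complex.ofReal_tsum, ne_eq, OfNat.ofNat_ne_zero, not_false_eq_true, zero_pow,
        Real.sqrt_zero, zero_div, Nat.ofNat_nonneg, cutoff_eq_one] at h0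
      exact_mod_cast h0
    exact h1 ▸ hs.hasSum
  symm_fst i j := lowPass_eq_of_sq_add_sq_eq N (by ring)
  symm_snd i j := lowPass_eq_of_sq_add_sq_eq N (by ring)
  isotropic := ⟨fun r => cutoff N (r / (2 * Real.pi)), fun _ _ h₁ h₁' h₂ h₂' =>
    fourierTransform_lowPass hN (abs_le.2 ⟨h₁.le, h₁'⟩) (abs_le.2 ⟨h₂.le, h₂'⟩)⟩
  differentiable := differentiable_fourierTransform (summable_norm_mul_lowPass (by lia))
  bounded_grad := exists_gradNorm_le (summable_norm_mul_lowPass (by lia))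

/-! ### Cell averages -/

/-- The half-open unit square. -/
def unitCell : Set (ℝ × ℝ) := Set.Ico 0 1 ×ˢ Set.Ico 0 1

/-- The part of the rescaled cell `(i, j)` of the grid of mesh `1 / n` that lies under the
graph of `h`. -/
def subgraphCell (h : ℝ → ℝ) (n : ℕ) (i j : ℤ) : Set (ℝ × ℝ) :=
  {u | u ∈ unitCell ∧ (j + u.2) / n < h ((i + u.1) / n)}

/-- The fraction of the cell `(i, j)` of the grid of mesh `1 / n` that lies under the graph
of `h`. -/
def cellAverage (h : ℝ → ℝ) (n : ℕ) (i j : ℤ) : ℝ := volume.real (subgraphCell h n i j)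

theorem volume_unitCell : volume unitCell = 1 := by
  rw [unitCell, Measure.volume_eq_prod, Measure.prod_prod]
  simp

theorem cellAverage_mono {h : ℝ → ℝ} {n : ℕ} {i j i' j' : ℤ}
    (H : ∀ u ∈ unitCell, (j + u.2) / n < h ((i + u.1) / n) →
      (j' + u.2) / n < h ((i' + u.1) / n)) :
    cellAverage h n i j ≤ cellAverage h n i' j' :=
  measureReal_mono (fun u hu => ⟨hu.1, H u hu.1 hu.2⟩)
    ((measure_mono fun _ hu => hu.1).trans_lt (volume_unitCell.trans_lt ENNReal.one_lt_top)).ne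

theorem cellAverage_nonneg (h : ℝ → ℝ) (n : ℕ) (i j : ℤ) : 0 ≤ cellAverage h n i j :=
  measureReal_nonneg

theorem cellAverage_le_one (h : ℝ → ℝ) (n : ℕ) (i j : ℤ) : cellAverage h n i j ≤ 1 := by
  have h1 : volume.real unitCell = 1 := by simp [measureReal_def, volume_unitCell]
  rw [← h1]
  exact measureReal_mono (fun u hu => hu.1) (by simp [volume_unitCell])

theorem cellAverage_eq_one {h : ℝ → ℝ} {n : ℕ} {i j : ℤ}
    (H : ∀ u ∈ unitCell, (j + u.2) / n < h ((i + u.1) / n)) : cellAverage h n i j = 1 := by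
  have : subgraphCell h n i j = unitCell :=
    Set.ext fun u => ⟨fun hu => hu.1, fun hu => ⟨hu, H u hu⟩⟩
  simp [cellAverage, this, measureReal_def, volume_unitCell]

theorem cellAverage_eq_zero {h : ℝ → ℝ} {n : ℕ} {i j : ℤ}
    (H : ∀ u ∈ unitCell, h ((i + u.1) / n) ≤ (j + u.2) / n) : cellAverage h n i j = 0 := by
  have : subgraphCell h n i j = ∅ :=
    Set.eq_empty_of_forall_notMem fun u hu => (H u hu.1).not_gt hu.2
  simp [cellAverage, this]

theorem cellAverage_antitone_snd (h : ℝ → ℝ) (n : ℕ) (i : ℤ) :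
    Antitone fun j => cellAverage h n i j := by
  intro j j' hj
  refine cellAverage_mono fun u _ hu => lt_of_le_of_lt ?_ hu
  have : (j : ℝ) ≤ j' := by exact_mod_cast hj
  gcongr

theorem volume_preimage_rescale {n : ℕ} (hn : n ≠ 0) (c : ℝ × ℝ) (s : Set (ℝ × ℝ)) :
    volume.real ((fun t : ℝ × ℝ => (n : ℝ) • t) ⁻¹' ((fun t => t - c) ⁻¹' s)) =
      ((n : ℝ) ^ 2)⁻¹ * volume.real s := by
  have hn' : (n : ℝ) ≠ 0 := by exact_mod_cast hn
  simp_rw [sub_eq_add_neg]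
  rw [measureReal_def, Measure.addHaar_preimage_smul _ hn', measure_preimage_add_right,
    ENNReal.toReal_mul, ENNReal.toReal_ofReal (abs_nonneg _), measureReal_def]
  simp

theorem pixelAverage_horizonImage {h : ℝ → ℝ} (hh : Continuous h) {n : ℕ} [NeZero n]
    (i j : ZMod n) :
    pixelAverage n (horizonImage h) i j = cellAverage h n i.val j.val := by
  have hn : (0 : ℝ) < n := by exact_mod_cast Nat.pos_of_neZero n
  set c : ℝ × ℝ := ((i.val : ℝ), (j.val : ℝ)) with hc
  have hpix : pixel n i j =
      (fun t : ℝ × ℝ => (n : ℝ) • t) ⁻¹' ((fun t => t - c) ⁻¹' unitCell) := by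
    ext t
    simp only [pixel, unitCell, hc, Set.mem_prod, Set.mem_Ico, Set.mem_preimage, Prod.fst_sub,
      Prod.snd_sub, Prod.smul_fst, Prod.smul_snd, smul_eq_mul, div_le_iff₀ hn, lt_div_iff₀ hn]
    constructor <;> rintro ⟨⟨h1, h2⟩, h3, h4⟩ <;> refine ⟨⟨?_, ?_⟩, ?_, ?_⟩ <;> linarith
  have hsub : pixel n i j ∩ {t : ℝ × ℝ | t.2 < h t.1} =
      (fun t : ℝ × ℝ => (n : ℝ) • t) ⁻¹' ((fun t => t - c) ⁻¹'
        subgraphCell h n i.val j.val) := by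
    rw [hpix]
    ext t
    have h1 : (((i.val : ℤ) : ℝ) + ((n : ℝ) * t.1 - (i.val : ℝ))) / n = t.1 := by
      push_cast; field_simp; ring
    have h2 : (((j.val : ℤ) : ℝ) + ((n : ℝ) * t.2 - (j.val : ℝ))) / n = t.2 := by
      push_cast; field_simp; ring
    simp only [Set.mem_inter_iff, Set.mem_preimage, Set.mem_ofPred_eq, subgraphCell, hc,
      Prod.fst_sub, Prod.snd_sub, Prod.smul_fst, Prod.smul_snd, smul_eq_mul, h1, h2]
  have hmeas : MeasurableSet {t : ℝ × ℝ | t.2 < h t.1} :=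
    (isOpen_lt continuous_snd (hh.comp continuous_fst)).measurableSet
  rw [pixelAverage, setAverage_eq, horizonImage, setIntegral_indicator hmeas, hsub, hpix,
    volume_preimage_rescale (NeZero.ne n)]
  simp only [integral_const, smul_eq_mul, mul_one, measureReal_restrict_apply MeasurableSet.univ,
    Set.univ_inter]
  rw [volume_preimage_rescale (NeZero.ne n), measureReal_def, volume_unitCell, cellAverage]
  simp only [ENNReal.toReal_one]
  field_simp

/-! ### Variation along shifts of the torus -/

section ShiftVariation

variable {A : Type*} [AddCommGroup A] [Fintype A]

/-- The `ℓ¹` distance between a function on a finite group and its translate by `c`. -/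
def shiftVariation (x : A → ℝ) (c : A) : ℝ := ∑ a, |x a - x (a - c)|

theorem shiftVariation_add_le (x : A → ℝ) (c d : A) :
    shiftVariation x (c + d) ≤ shiftVariation x c + shiftVariation x d := by
  have h : shiftVariation x d = ∑ a, |x (a - c) - x (a - c - d)| :=
    (Equiv.sum_comp (Equiv.subRight c) fun a => |x a - x (a - d)|).symm
  rw [h, shiftVariation, shiftVariation, ← Finset.sum_add_distrib]
  refine Finset.sum_le_sum fun a _ => ?_
  rw [← sub_sub]
  exact abs_sub_le _ _ _

theorem shiftVariation_neg (x : A → ℝ) (c : A) :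
    shiftVariation x (-c) = shiftVariation x c := by
  rw [shiftVariation, shiftVariation, ← Equiv.sum_comp (Equiv.subRight c)]
  refine Finset.sum_congr rfl fun a _ => ?_
  simp [abs_sub_comm]

theorem shiftVariation_nsmul_le (x : A → ℝ) (c : A) (m : ℕ) :
    shiftVariation x (m • c) ≤ m * shiftVariation x c := by
  induction m with
  | zero => simp [shiftVariation]
  | succ m ih =>
    calc shiftVariation x ((m + 1) • c) ≤ shiftVariation x (m • c) + shiftVariation x c :=
          succ_nsmul c m ▸ shiftVariation_add_le x _ _
      _ ≤ (m + 1 : ℕ) * shiftVariation x c := by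
          push_cast
          linarith

theorem sum_sub_translate_sq_le {x : A → ℝ} (hx : ∀ a, x a ∈ Set.Icc 0 1) (c : A) :
    ∑ a, (x a - x (a - c)) ^ 2 ≤ shiftVariation x c := by
  refine Finset.sum_le_sum fun a _ => ?_
  have h1 : |x a - x (a - c)| ≤ 1 :=
    abs_le.2 ⟨by linarith [(hx a).1, (hx (a - c)).2], by linarith [(hx a).2, (hx (a - c)).1]⟩
  rw [← sq_abs, sq]
  exact mul_le_of_le_one_left (abs_nonneg _) h1

/-- The increments sum to zero, so their total variation is twice the total decrease. -/
theorem shiftVariation_le_of_le_off {x : A → ℝ} (hx : ∀ a, x a ∈ Set.Icc 0 1) {c : A}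
    {S : Finset A} (h : ∀ a ∉ S, x (a - c) ≤ x a) : shiftVariation x c ≤ 2 * S.card := by
  classical
  have hsum : ∑ a, (x a - x (a - c)) = 0 := by
    rw [Finset.sum_sub_distrib, sub_eq_zero]
    exact (Equiv.sum_comp (Equiv.subRight c) x).symm
  have hterm (a : A) : |x a - x (a - c)| ≤ x a - x (a - c) + if a ∈ S then 2 else 0 := by
    split_ifs with ha
    · rw [abs_le]
      constructor <;> linarith [(hx a).1, (hx (a - c)).2, (hx a).2, (hx (a - c)).1]
    · rw [add_zero, abs_of_nonneg (sub_nonneg.2 (h a ha))]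
  refine (Finset.sum_le_sum fun a _ => hterm a).trans_eq ?_
  rw [Finset.sum_add_distrib, hsum, zero_add, Finset.sum_ite_mem, Finset.univ_inter,
    Finset.sum_const, nsmul_eq_mul, mul_comm]

end ShiftVariation

theorem intCast_val_sub_one {n : ℕ} [NeZero n] {b : ZMod n} (hb : b ≠ 0) :
    ((b - 1).val : ℤ) = b.val - 1 := by
  have : Nontrivial (ZMod n) := ⟨b, 0, hb⟩
  have : Fact (1 < n) := ⟨(ZMod.nontrivial_iff.1 this).lt_of_le' (NeZero.one_le)⟩
  have hb' : 1 ≤ b.val := Nat.one_le_iff_ne_zero.2 ((ZMod.val_ne_zero b).2 hb)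
  rw [ZMod.val_sub ((ZMod.val_one n).trans_le hb'), ZMod.val_one, Nat.cast_sub hb', Nat.cast_one]

theorem intCast_val_add_one {n : ℕ} [NeZero n] {b : ZMod n} (hb : b ≠ -1) :
    ((b + 1).val : ℤ) = b.val + 1 := by
  have h := intCast_val_sub_one (b := b + 1) fun h => hb (eq_neg_of_add_eq_zero_left h)
  rw [add_sub_cancel_right] at h
  lia

/-! ### Variation of horizon images -/

theorem continuous_and_monotone_of_mem_holderClass {k : ℕ} (hk : (1 : ℝ) - k ∈ Set.Icc 0 1)
    {h : ℝ → ℝ} (hh : h ∈ HolderClass k 1 1) :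
    Continuous h ∧ ((Monotone fun t => h t + t) ∨ Antitone fun t => h t - t) := by
  obtain ⟨hd, hb⟩ := hh
  obtain rfl | rfl : k = 1 ∨ k = 0 := by
    have : k ≤ 1 := by exact_mod_cast sub_nonneg.1 hk.1
    lia
  · have hdiff : Differentiable ℝ h := by simpa using hd 0 one_pos
    simp only [iteratedDeriv_one, Nat.cast_one, sub_self, Real.rpow_zero, mul_one] at hb
    have hadd (t : ℝ) : deriv (fun t => h t + t) t = deriv h t + 1 :=
      ((hdiff t).hasDerivAt.add (hasDerivAt_id t)).deriv
    have hsub (t : ℝ) : deriv (fun t => h t - t) t = deriv h t - 1 :=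
      ((hdiff t).hasDerivAt.sub (hasDerivAt_id t)).deriv
    refine ⟨hdiff.continuous, (le_total 0 (deriv h 0)).imp (fun h0 => ?_) fun h0 => ?_⟩
    · refine monotone_of_deriv_nonneg (hdiff.add differentiable_id) fun t => ?_
      rw [hadd]
      linarith [(abs_le.1 (hb t 0)).1]
    · refine antitone_of_deriv_nonpos (hdiff.sub differentiable_id) fun t => ?_
      rw [hsub]
      linarith [(abs_le.1 (hb t 0)).2]
  · simp only [iteratedDeriv_zero, Nat.cast_zero, sub_zero, Real.rpow_one, one_mul] at hb
    have hlip : LipschitzWith 1 h :=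
      .of_dist_le_mul fun t t' => by simpa [Real.dist_eq] using hb t t'
    refine ⟨hlip.continuous, Or.inl fun t t' htt' => ?_⟩
    have := (abs_le.1 (hb t t')).2
    rw [abs_sub_comm, abs_of_nonneg (sub_nonneg.2 htt')] at this
    dsimp only
    linarith

section HorizonImage

variable {h : ℝ → ℝ} (n : ℕ) [NeZero n]

theorem pixelImage_horizonImage (hc : Continuous h) :
    pixelImage n (horizonImage h) = fun a => cellAverage h n a.1.val a.2.val :=
  funext fun a => pixelAverage_horizonImage hc a.1 a.2

theorem pixelImage_horizonImage_mem_Icc (hc : Continuous h) (a : ZMod n × ZMod n) :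
    pixelImage n (horizonImage h) a ∈ Set.Icc 0 1 := by
  rw [pixelImage_horizonImage n hc]
  exact ⟨cellAverage_nonneg _ _ _ _, cellAverage_le_one _ _ _ _⟩

theorem card_fst_eq_or_snd_eq_le (u v : ZMod n) :
    (Finset.univ.filter fun a : ZMod n × ZMod n => a.1 = u ∨ a.2 = v).card ≤ 2 * n := by
  classical
  rw [Finset.filter_or]
  refine (Finset.card_union_le _ _).trans_eq ?_
  have hu : (Finset.univ.filter fun a : ZMod n × ZMod n => a.1 = u) = {u} ×ˢ Finset.univ := by
    ext ⟨i, j⟩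
    simp [eq_comm]
  have hv : (Finset.univ.filter fun a : ZMod n × ZMod n => a.2 = v) = Finset.univ ×ˢ {v} := by
    ext ⟨i, j⟩
    simp [eq_comm]
  rw [hu, hv, Finset.card_product, Finset.card_product, Finset.card_univ, ZMod.card,
    Finset.card_singleton, Finset.card_singleton, one_mul, mul_one, two_mul]

theorem shiftVariation_le_of_cellAverage_le (hc : Continuous h) {c : ZMod n × ZMod n}
    {u v : ZMod n} (H : ∀ a : ZMod n × ZMod n, a.1 ≠ u → a.2 ≠ v →
      cellAverage h n (a.1 - c.1).val (a.2 - c.2).val ≤ cellAverage h n a.1.val a.2.val) :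
    shiftVariation (pixelImage n (horizonImage h)) c ≤ 4 * n := by
  have hcard : ((Finset.univ.filter fun a : ZMod n × ZMod n => a.1 = u ∨ a.2 = v).card : ℝ) ≤
      2 * n := by exact_mod_cast card_fst_eq_or_snd_eq_le n u v
  refine (shiftVariation_le_of_le_off (pixelImage_horizonImage_mem_Icc n hc) (S := _)
    fun a ha => ?_).trans (by linarith)
  simp only [Finset.mem_filter, Finset.mem_univ, true_and, not_or] at ha
  rw [pixelImage_horizonImage n hc]
  exact H a ha.1 ha.2

theorem shiftVariation_snd_le (hc : Continuous h) :
    shiftVariation (pixelImage n (horizonImage h)) (0, 1) ≤ 4 * n := by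
  rw [← shiftVariation_neg]
  refine shiftVariation_le_of_cellAverage_le n hc (u := 0) (v := -1) fun a _ ha => ?_
  simp only [Prod.fst_neg, Prod.snd_neg, neg_zero, sub_zero, sub_neg_eq_add,
    intCast_val_add_one ha]
  exact cellAverage_antitone_snd h n _ (by lia)

theorem shiftVariation_diagonal_le (hc : Continuous h) (hm : Monotone fun t => h t + t) :
    shiftVariation (pixelImage n (horizonImage h)) (1, -1) ≤ 4 * n := by
  refine shiftVariation_le_of_cellAverage_le n hc (u := 0) (v := -1) fun a ha₁ ha₂ => ?_
  simp only [sub_neg_eq_add, intCast_val_sub_one ha₁, intCast_val_add_one ha₂]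
  refine cellAverage_mono fun u _ hu => ?_
  have hmono := hm (a := (((a.1.val - 1 : ℤ) : ℝ) + u.1) / n) (b := (a.1.val + u.1) / n)
    (by gcongr; simp)
  push_cast [add_div, sub_div] at hmono hu ⊢
  linarith

theorem shiftVariation_antidiagonal_le (hc : Continuous h) (hm : Antitone fun t => h t - t) :
    shiftVariation (pixelImage n (horizonImage h)) (1, 1) ≤ 4 * n := by
  rw [← shiftVariation_neg]
  refine shiftVariation_le_of_cellAverage_le n hc (u := -1) (v := -1) fun a ha₁ ha₂ => ?_
  simp only [Prod.fst_neg, Prod.snd_neg, sub_neg_eq_add, intCast_val_add_one ha₁,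
    intCast_val_add_one ha₂]
  refine cellAverage_mono fun u _ hu => ?_
  have hanti := hm (a := (a.1.val + u.1) / n) (b := (((a.1.val + 1 : ℤ) : ℝ) + u.1) / n)
    (by gcongr; simp)
  push_cast [add_div] at hanti hu ⊢
  linarith

theorem shiftVariation_fst_le (hc : Continuous h)
    (hm : (Monotone fun t => h t + t) ∨ Antitone fun t => h t - t) :
    shiftVariation (pixelImage n (horizonImage h)) (1, 0) ≤ 8 * n := by
  have hsnd := shiftVariation_snd_le n hc
  rcases hm with hm | hm
  · have hadd := shiftVariation_add_le (pixelImage n (horizonImage h)) (1, -1) (0, 1)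
    rw [Prod.mk_add_mk, add_zero, neg_add_cancel] at hadd
    linarith [shiftVariation_diagonal_le n hc hm]
  · have hadd := shiftVariation_add_le (pixelImage n (horizonImage h)) (1, 1) (-(0, 1))
    rw [shiftVariation_neg, Prod.neg_mk, Prod.mk_add_mk, neg_zero, add_zero,
      add_neg_cancel] at hadd
    linarith [shiftVariation_antidiagonal_le n hc hm]

end HorizonImage

/-! ### Risk of the low-pass filters -/

/-- The powers of `z` on the unit circle with `m < N` cannot all stay close to one, as the
geometric sum is at most `2 / ‖1 - z‖`. -/
theorem le_sum_norm_one_sub_pow_sq {z : ℂ} (hz : ‖z‖ = 1) {N : ℕ} (h : 4 ≤ N * ‖1 - z‖) :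
    (N : ℝ) ≤ ∑ m ∈ Finset.range N, ‖1 - z ^ m‖ ^ 2 := by
  have hterm (m : ℕ) : ‖1 - z ^ m‖ ^ 2 = 2 - 2 * (z ^ m).re := by
    have hm : ‖z ^ m‖ ^ 2 = 1 := by rw [norm_pow, hz, one_pow, one_pow]
    rw [Complex.sq_norm, Complex.normSq_apply] at hm ⊢
    simp only [Complex.sub_re, Complex.sub_im, Complex.one_re, Complex.one_im]
    linarith
  set s := ∑ m ∈ Finset.range N, z ^ m
  have hgeom : ‖s‖ * ‖1 - z‖ ≤ 2 := by
    rw [← norm_mul, geom_sum_mul_neg]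
    refine (norm_sub_le _ _).trans_eq ?_
    rw [norm_one, norm_pow, hz, one_pow, one_add_one_eq_two]
  have hs : 2 * s.re ≤ N := by
    have hpos : 0 < ‖1 - z‖ := by
      by_contra! h0
      rw [le_antisymm h0 (norm_nonneg _)] at h
      linarith
    have : 2 * ‖s‖ ≤ N := by
      refine le_of_mul_le_mul_right ?_ hpos
      linarith
    linarith [Complex.re_le_norm s]
  simp_rw [hterm]
  rw [Finset.sum_sub_distrib, Finset.sum_const, Finset.card_range, nsmul_eq_mul, ← Finset.mul_sum,
    ← Complex.re_sum]
  linarith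

section Torus

variable {n : ℕ} [NeZero n]

theorem stdAddChar_eq_exp_valMinAbs (j : ZMod n) :
    ZMod.stdAddChar j = Complex.exp (Complex.I * ↑(2 * Real.pi * j.valMinAbs / n)) := by
  conv_lhs => rw [← ZMod.coe_valMinAbs j]
  rw [ZMod.stdAddChar_coe]
  push_cast
  ring_nf

theorem abs_valMinAbs_div_le_half (j : ZMod n) : |(j.valMinAbs : ℝ)| / n ≤ 1 / 2 := by
  have hn : (0 : ℝ) < n := by exact_mod_cast Nat.pos_of_neZero n
  have h : 2 * j.valMinAbs.natAbs ≤ n := by have := j.natAbs_valMinAbs_le; lia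
  have h' : 2 * |(j.valMinAbs : ℝ)| ≤ n := by
    rw [← Int.cast_abs, ← Nat.cast_natAbs]
    exact_mod_cast h
  rw [div_le_iff₀ hn]
  linarith

theorem four_mul_abs_valMinAbs_div_le (j : ZMod n) :
    4 * (|(j.valMinAbs : ℝ)| / n) ≤ ‖1 - ZMod.stdAddChar j‖ := by
  have hangle : |2 * Real.pi * j.valMinAbs / n / 2| = Real.pi * (|(j.valMinAbs : ℝ)| / n) := by
    rw [abs_div, abs_div, abs_mul, abs_of_pos Real.two_pi_pos, Nat.abs_cast, abs_two]
    ring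
  have hsin := Real.mul_abs_le_abs_sin (x := 2 * Real.pi * j.valMinAbs / n / 2) (by
    rw [hangle]
    nlinarith [Real.pi_pos, abs_valMinAbs_div_le_half j])
  rw [hangle] at hsin
  rw [norm_sub_rev, stdAddChar_eq_exp_valMinAbs, Complex.norm_exp_I_mul_ofReal_sub_one, norm_mul,
    Real.norm_two, Real.norm_eq_abs]
  have : 2 / Real.pi * (Real.pi * (|(j.valMinAbs : ℝ)| / n)) = 2 * (|(j.valMinAbs : ℝ)| / n) := by
    field_simp
  linarith

theorem sum_norm_one_sub_torusChar_pow_sq_mul_le {u : ZMod n × ZMod n → ℝ}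
    (hu : ∀ a, u a ∈ Set.Icc 0 1) (c : ZMod n × ZMod n) (m : ℕ) :
    ∑ k, ‖1 - torusChar k c ^ m‖ ^ 2 * ‖torusDFT u k‖ ^ 2 ≤
      (n : ℝ) ^ 2 * (m * shiftVariation u c) :=
  calc ∑ k, ‖1 - torusChar k c ^ m‖ ^ 2 * ‖torusDFT u k‖ ^ 2
      = ∑ k, ‖torusDFT (fun a => u a - u (a - -(m • c))) k‖ ^ 2 := by
        simp_rw [torusDFT_sub_translate, neg_neg, AddChar.map_nsmul_eq_pow, norm_mul, mul_pow]
    _ = (n : ℝ) ^ 2 * ∑ a, (u a - u (a - -(m • c))) ^ 2 := sum_norm_sq_torusDFT _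
    _ ≤ (n : ℝ) ^ 2 * (m * shiftVariation u c) := by
        gcongr
        refine (sum_sub_translate_sq_le hu _).trans ?_
        rw [shiftVariation_neg]
        exact shiftVariation_nsmul_le u c m

theorem sum_norm_sq_torusDFT_le_of_shiftVariation_le {u : ZMod n × ZMod n → ℝ}
    (hu : ∀ a, u a ∈ Set.Icc 0 1) {c : ZMod n × ZMod n} {V : ℝ} (hV : shiftVariation u c ≤ V)
    {N : ℕ} (hN : 0 < N) {S : Finset (ZMod n × ZMod n)}
    (hS : ∀ k ∈ S, 4 ≤ N * ‖1 - torusChar k c‖) :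
    ∑ k ∈ S, ‖torusDFT u k‖ ^ 2 ≤ (n : ℝ) ^ 2 * (N * V) := by
  have hV0 : 0 ≤ shiftVariation u c := Finset.sum_nonneg fun _ _ => abs_nonneg _
  have hN' : (0 : ℝ) < N := by exact_mod_cast hN
  refine le_of_mul_le_mul_left ?_ hN'
  calc N * ∑ k ∈ S, ‖torusDFT u k‖ ^ 2
      ≤ ∑ k ∈ S, (∑ m ∈ Finset.range N, ‖1 - torusChar k c ^ m‖ ^ 2) * ‖torusDFT u k‖ ^ 2 := by
        rw [Finset.mul_sum]
        gcongr with k hk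
        exact le_sum_norm_one_sub_pow_sq (AddChar.norm_apply _ _) (hS k hk)
    _ ≤ ∑ k, (∑ m ∈ Finset.range N, ‖1 - torusChar k c ^ m‖ ^ 2) * ‖torusDFT u k‖ ^ 2 :=
        Finset.sum_le_univ_sum_of_nonneg fun _ => by positivity
    _ = ∑ m ∈ Finset.range N, ∑ k, ‖1 - torusChar k c ^ m‖ ^ 2 * ‖torusDFT u k‖ ^ 2 := by
        simp_rw [Finset.sum_mul]
        exact Finset.sum_comm
    _ ≤ ∑ m ∈ Finset.range N, (n : ℝ) ^ 2 * (N * V) := by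
        gcongr with m hm
        refine (sum_norm_one_sub_torusChar_pow_sq_mul_le hu c m).trans ?_
        gcongr
        exact (Finset.mem_range.1 hm).le
    _ = N * ((n : ℝ) ^ 2 * (N * V)) := by
        rw [Finset.sum_const, Finset.card_range, nsmul_eq_mul]

theorem torusDFT_periodize_lowPass {N : ℕ} (hN : 4 ≤ N) (k : ZMod n × ZMod n) :
    torusDFT (periodize (lowPass N) n) k =
      cutoff N (Real.sqrt ((k.1.valMinAbs / n) ^ 2 + (k.2.valMinAbs / n) ^ 2)) := by
  have hangle (j : ZMod n) : |2 * Real.pi * j.valMinAbs / n| ≤ Real.pi := by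
    rw [mul_div_assoc, abs_mul, abs_of_pos Real.two_pi_pos, abs_div, Nat.abs_cast]
    nlinarith [Real.pi_pos, abs_valMinAbs_div_le_half j]
  have hradius (v w : ℝ) : (2 * Real.pi * v / n) ^ 2 + (2 * Real.pi * w / n) ^ 2 =
      (2 * Real.pi) ^ 2 * ((v / n) ^ 2 + (w / n) ^ 2) := by ring
  rw [torusDFT_periodize_eq_fourierTransform (summable_of_summable_norm_mul
    (summable_norm_mul_lowPass (by lia))), fourierTransform_lowPass hN (hangle _) (hangle _),
    hradius, Real.sqrt_mul (by positivity), Real.sqrt_sq Real.two_pi_pos.le,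
    mul_div_cancel_left₀ _ Real.two_pi_pos.ne']

theorem torusDFT_periodize_lowPass_eq_one {N : ℕ} (hN : 4 ≤ N) {k : ZMod n × ZMod n}
    (h₁ : N * (|(k.1.valMinAbs : ℝ)| / n) ≤ 1) (h₂ : N * (|(k.2.valMinAbs : ℝ)| / n) ≤ 1) :
    torusDFT (periodize (lowPass N) n) k = 1 := by
  have hsq {v : ℝ} (h : N * (|v| / n) ≤ 1) : (N : ℝ) ^ 2 * (v / n) ^ 2 ≤ 1 := by
    rw [← sq_abs (v / n), abs_div, Nat.abs_cast, ← mul_pow]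
    exact pow_le_one₀ (by positivity) h
  rw [torusDFT_periodize_lowPass hN, cutoff_eq_one, Complex.ofReal_one]
  rw [mul_pow, Real.sq_sqrt (by positivity), mul_add]
  linarith [hsq h₁, hsq h₂]

theorem torusDFT_periodize_lowPass_eq_zero {N : ℕ} (hN : 4 ≤ N) {k : ZMod n × ZMod n}
    (h : 2 ≤ N * (|(k.1.valMinAbs : ℝ)| / n) ∨ 2 ≤ N * (|(k.2.valMinAbs : ℝ)| / n)) :
    torusDFT (periodize (lowPass N) n) k = 0 := by
  have hsq {v : ℝ} (h : 2 ≤ N * (|v| / n)) : 4 ≤ (N : ℝ) ^ 2 * (v / n) ^ 2 := by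
    rw [← sq_abs (v / n), abs_div, Nat.abs_cast, ← mul_pow]
    nlinarith
  rw [torusDFT_periodize_lowPass hN, cutoff_eq_zero, Complex.ofReal_zero]
  rw [mul_pow, Real.sq_sqrt (by positivity), mul_add]
  rcases h with h | h
  · linarith [hsq h, show 0 ≤ (N : ℝ) ^ 2 * (k.2.valMinAbs / n : ℝ) ^ 2 by positivity]
  · linarith [hsq h, show 0 ≤ (N : ℝ) ^ 2 * (k.1.valMinAbs / n : ℝ) ^ 2 by positivity]

theorem norm_torusDFT_periodize_lowPass_le_one {N : ℕ} (hN : 4 ≤ N) (k : ZMod n × ZMod n) :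
    ‖torusDFT (periodize (lowPass N) n) k‖ ≤ 1 ∧
      ‖1 - torusDFT (periodize (lowPass N) n) k‖ ≤ 1 := by
  obtain ⟨h0, h1⟩ := cutoff_mem_Icc N
    (Real.sqrt ((k.1.valMinAbs / n) ^ 2 + (k.2.valMinAbs / n) ^ 2))
  rw [torusDFT_periodize_lowPass hN, ← Complex.ofReal_one, ← Complex.ofReal_sub,
    Complex.norm_real, Complex.norm_real, Real.norm_eq_abs, Real.norm_eq_abs]
  exact ⟨abs_le.2 ⟨by linarith, h1⟩, abs_le.2 ⟨by linarith, by linarith⟩⟩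

theorem norm_one_sub_torusDFT_periodize_lowPass_sq_le {N : ℕ} (hN : 4 ≤ N)
    (k : ZMod n × ZMod n) :
    ‖1 - torusDFT (periodize (lowPass N) n) k‖ ^ 2 ≤
      (if 1 ≤ N * (|(k.1.valMinAbs : ℝ)| / n) then 1 else 0) +
        if 1 ≤ N * (|(k.2.valMinAbs : ℝ)| / n) then 1 else 0 := by
  have hle : ‖1 - torusDFT (periodize (lowPass N) n) k‖ ^ 2 ≤ 1 :=
    pow_le_one₀ (norm_nonneg _) (norm_torusDFT_periodize_lowPass_le_one hN k).2
  split_ifs with h₁ h₂ h₂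
  · linarith
  · linarith
  · linarith
  · rw [torusDFT_periodize_lowPass_eq_one hN (not_le.1 h₁).le (not_le.1 h₂).le]
    simp

theorem sum_bias_lowPass_le {N : ℕ} (hN : 4 ≤ N) {u : ZMod n × ZMod n → ℝ}
    (hu : ∀ a, u a ∈ Set.Icc 0 1) {V : ℝ} (h₁ : shiftVariation u (1, 0) ≤ V)
    (h₂ : shiftVariation u (0, 1) ≤ V) :
    ∑ k, ‖1 - torusDFT (periodize (lowPass N) n) k‖ ^ 2 * ‖torusDFT u k‖ ^ 2 ≤
      2 * ((n : ℝ) ^ 2 * (N * V)) := by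
  have hfar {j : ZMod n} (hj : 1 ≤ N * (|(j.valMinAbs : ℝ)| / n)) :
      4 ≤ N * ‖1 - ZMod.stdAddChar j‖ := by
    have := mul_le_mul_of_nonneg_left (four_mul_abs_valMinAbs_div_le j) N.cast_nonneg
    linarith
  have hsum₁ : ∑ k with 1 ≤ N * (|(k.1.valMinAbs : ℝ)| / n), ‖torusDFT u k‖ ^ 2 ≤
      (n : ℝ) ^ 2 * (N * V) :=
    sum_norm_sq_torusDFT_le_of_shiftVariation_le hu h₁ (by lia) fun k hk => by
      simpa [torusChar_apply] using hfar (Finset.mem_filter.1 hk).2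
  have hsum₂ : ∑ k with 1 ≤ N * (|(k.2.valMinAbs : ℝ)| / n), ‖torusDFT u k‖ ^ 2 ≤
      (n : ℝ) ^ 2 * (N * V) :=
    sum_norm_sq_torusDFT_le_of_shiftVariation_le hu h₂ (by lia) fun k hk => by
      simpa [torusChar_apply] using hfar (Finset.mem_filter.1 hk).2
  refine (Finset.sum_le_sum fun k _ => mul_le_mul_of_nonneg_right
    (norm_one_sub_torusDFT_periodize_lowPass_sq_le hN k) (sq_nonneg _)).trans ?_
  simp only [add_mul, ite_mul, one_mul, zero_mul]
  rw [Finset.sum_add_distrib, ← Finset.sum_filter, ← Finset.sum_filter]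
  linarith

theorem card_natAbs_valMinAbs_le (r : ℕ) :
    (Finset.univ.filter fun j : ZMod n => j.valMinAbs.natAbs ≤ r).card ≤ 2 * r + 1 := by
  calc (Finset.univ.filter fun j : ZMod n => j.valMinAbs.natAbs ≤ r).card
      ≤ (Finset.Icc (-r : ℤ) r).card := by
        refine Finset.card_le_card_of_injOn ZMod.valMinAbs (fun j hj => ?_)
          (ZMod.injective_valMinAbs.injOn)
        have : j.valMinAbs.natAbs ≤ r := by simpa using hj
        exact Finset.mem_Icc.2 (by lia)
    _ = 2 * r + 1 := by
        rw [Int.card_Icc]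
        lia

theorem card_mul_abs_valMinAbs_div_lt_two_le {N : ℕ} (hN : 0 < N) (hNn : N ≤ n) :
    ((Finset.univ.filter fun j : ZMod n => N * (|(j.valMinAbs : ℝ)| / n) < 2).card : ℝ) ≤
      5 * (n / N) := by
  have hn : (0 : ℝ) < n := by exact_mod_cast Nat.pos_of_neZero n
  have hN' : (0 : ℝ) < N := by exact_mod_cast hN
  set r := 2 * n / N
  have hsub : (Finset.univ.filter fun j : ZMod n => N * (|(j.valMinAbs : ℝ)| / n) < 2) ⊆
      Finset.univ.filter fun j : ZMod n => j.valMinAbs.natAbs ≤ r := by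
    refine Finset.monotone_filter_right _ fun j _ hj => ?_
    rw [← Int.cast_abs, ← Nat.cast_natAbs, mul_div_assoc', div_lt_iff₀ hn] at hj
    norm_cast at hj
    exact (Nat.le_div_iff_mul_le hN).2 ((mul_comm _ _).trans_le hj.le)
  have hcard := Nat.cast_le (α := ℝ).2
    ((Finset.card_le_card hsub).trans (card_natAbs_valMinAbs_le r))
  have hr : (r : ℝ) ≤ 2 * (n / N) := by
    refine Nat.cast_div_le.trans_eq ?_
    push_cast
    ring
  have hone : (1 : ℝ) ≤ n / N := (one_le_div hN').2 (by exact_mod_cast hNn)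
  push_cast at hcard
  linarith

theorem sum_norm_sq_torusDFT_periodize_lowPass_le {N : ℕ} (hN : 4 ≤ N) (hNn : N ≤ n) :
    ∑ k : ZMod n × ZMod n, ‖torusDFT (periodize (lowPass N) n) k‖ ^ 2 ≤ (5 * (n / N : ℝ)) ^ 2 := by
  set B := Finset.univ.filter fun j : ZMod n => N * (|(j.valMinAbs : ℝ)| / n) < 2 with hB
  have hmem {j : ZMod n} (hj : j ∉ B) : 2 ≤ N * (|(j.valMinAbs : ℝ)| / n) := by
    simpa [hB] using hj
  calc ∑ k : ZMod n × ZMod n, ‖torusDFT (periodize (lowPass N) n) k‖ ^ 2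
      = ∑ k ∈ B ×ˢ B, ‖torusDFT (periodize (lowPass N) n) k‖ ^ 2 := by
        refine (Finset.sum_subset (Finset.subset_univ _) fun k _ hk => ?_).symm
        rw [Finset.mem_product, not_and_or] at hk
        rw [torusDFT_periodize_lowPass_eq_zero hN (hk.imp hmem hmem), norm_zero,
          zero_pow two_ne_zero]
    _ ≤ ∑ k ∈ B ×ˢ B, 1 := by
        gcongr with k
        exact pow_le_one₀ (norm_nonneg _) (norm_torusDFT_periodize_lowPass_le_one hN k).1
    _ = (B.card : ℝ) ^ 2 := by simp [sq]
    _ ≤ (5 * (n / N : ℝ)) ^ 2 := by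
        gcongr
        exact card_mul_abs_valMinAbs_div_lt_two_le (by lia) hNn

end Torus

theorem risk_lowPass_le {n : ℕ} [NeZero n] {N : ℕ} (hN : 4 ≤ N) (hNn : N ≤ n) {h : ℝ → ℝ}
    (hc : Continuous h) (hm : (Monotone fun t => h t + t) ∨ Antitone fun t => h t - t) (σ : ℝ≥0) :
    risk σ n (horizonImage h) (lowPass N) ≤
      ENNReal.ofReal (16 * (N / n) + 25 * (σ : ℝ) ^ 2 / (N : ℝ) ^ 2) := by
  have hn : (0 : ℝ) < n := by exact_mod_cast Nat.pos_of_neZero n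
  have hbias := sum_bias_lowPass_le hN (pixelImage_horizonImage_mem_Icc n hc)
    (shiftVariation_fst_le n hc hm) ((shiftVariation_snd_le n hc).trans (by linarith))
  have hvar := sum_norm_sq_torusDFT_periodize_lowPass_le hN hNn
  rw [risk_eq_sum_frequencies (summable_of_summable_norm_mul
    (summable_norm_mul_lowPass (by lia))), Finset.sum_add_distrib, ← Finset.mul_sum]
  simp_rw [mul_div_assoc', ← Finset.sum_div]
  refine ENNReal.ofReal_le_ofReal (add_le_add ?_ ?_)
  · refine (div_le_div_of_nonneg_right hbias (by positivity)).trans_eq ?_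
    field_simp
    norm_num
  · refine (mul_le_mul_of_nonneg_left hvar (by positivity)).trans_eq ?_
    field_simp
    norm_num

theorem exists_isAdmissible_risk_le {ord : ℝ → ℕ} (h1 : (1 : ℝ) - ord 1 ∈ Set.Icc 0 1) (α C : ℝ)
    (σ : ℝ≥0) {n : ℕ} [NeZero n] (hn : 64 ≤ n) :
    ∃ g, IsAdmissible g ∧ ∀ f ∈ horizonClass ord α C,
      risk σ n f g ≤ ENNReal.ofReal ((32 + 25 * σ ^ 2) * (n : ℝ) ^ (-(2 / 3) : ℝ)) := by
  have hn0 : (0 : ℝ) ≤ n := n.cast_nonneg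
  set y : ℝ := (n : ℝ) ^ (1 / 3 : ℝ) with hy
  have hy3 : y ^ 3 = n := by
    rw [hy, ← Real.rpow_natCast, ← Real.rpow_mul hn0]
    norm_num
  have hyn : (n : ℝ) ^ (-(2 / 3) : ℝ) = 1 / y ^ 2 := by
    rw [hy, ← Real.rpow_natCast, ← Real.rpow_mul hn0, one_div, ← Real.rpow_neg hn0]
    norm_num
  have hy4 : 4 ≤ y := by
    refine le_of_pow_le_pow_left₀ three_ne_zero (by positivity) ?_
    rw [hy3]
    exact_mod_cast hn
  set N := ⌈y⌉₊
  have hyN : y ≤ N := Nat.le_ceil y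
  have hN2 : (N : ℝ) ≤ 2 * y := by linarith [Nat.ceil_lt_add_one (by linarith : 0 ≤ y)]
  have hN : 4 ≤ N := by exact_mod_cast hy4.trans hyN
  have hNn : N ≤ n := Nat.ceil_le.2 (by rw [← hy3]; nlinarith)
  refine ⟨lowPass N, isAdmissible_lowPass hN, ?_⟩
  rintro f ⟨h, ⟨-, hh⟩, rfl⟩
  obtain ⟨hc, hm⟩ := continuous_and_monotone_of_mem_holderClass h1 hh
  refine (risk_lowPass_le hN hNn hc hm σ).trans (ENNReal.ofReal_le_ofReal ?_)
  calc 16 * (N / n) + 25 * (σ : ℝ) ^ 2 / (N : ℝ) ^ 2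
      ≤ 16 * (2 * y / y ^ 3) + 25 * (σ : ℝ) ^ 2 / y ^ 2 := by
        rw [hy3]
        gcongr
    _ = (32 + 25 * σ ^ 2) * (n : ℝ) ^ (-(2 / 3) : ℝ) := by
        rw [hyn]
        field_simp
        ring

/-! ### The Fourier coefficients of a straight edge -/

section RowDrop

variable {n : ℕ}

/-- The drop of an image from the pixel below to a given pixel, without the jump from the top row
to the bottom row that comes from the periodic extension. -/
def rowDrop (x : ZMod n × ZMod n → ℝ) (a : ZMod n × ZMod n) : ℝ :=
  if a.2 = 0 then 0 else x (a - (0, 1)) - x a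

theorem sub_translate_eq_sub_rowDrop {x : ZMod n × ZMod n → ℝ} (hbot : ∀ i, x (i, 0) = 1)
    (htop : ∀ i, x (i, -1) = 0) (a : ZMod n × ZMod n) :
    x a - x (a - (0, 1)) = (if a.2 = 0 then 1 else 0) - rowDrop x a := by
  obtain ⟨i, j⟩ := a
  rcases eq_or_ne j 0 with rfl | hj
  · simp [rowDrop, hbot, htop]
  · simp [rowDrop, hj]

variable [NeZero n]

theorem sum_rowDrop {x : ZMod n × ZMod n → ℝ} (hbot : ∀ i, x (i, 0) = 1)
    (htop : ∀ i, x (i, -1) = 0) : ∑ a, rowDrop x a = n := by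
  have hsum : ∑ a, (x a - x (a - (0, 1))) = 0 := by
    rw [Finset.sum_sub_distrib, sub_eq_zero]
    exact (Equiv.sum_comp (Equiv.subRight _) x).symm
  have hrow : ∑ a : ZMod n × ZMod n, (if a.2 = 0 then 1 else 0 : ℝ) = n := by
    rw [Fintype.sum_prod_type]
    simp
  simp_rw [sub_translate_eq_sub_rowDrop hbot htop, Finset.sum_sub_distrib, hrow] at hsum
  linarith

theorem torusDFT_bottomRow {k : ZMod n × ZMod n} (hk : k.1 ≠ 0) :
    torusDFT (fun a => if a.2 = 0 then 1 else 0) k = 0 := by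
  have hchar := AddChar.sum_mulShift (-k.1) (ZMod.isPrimitive_stdAddChar n)
  rw [if_neg (neg_ne_zero.2 hk), Nat.cast_zero] at hchar
  rw [← hchar, torusDFT, Fintype.sum_prod_type]
  refine Finset.sum_congr rfl fun i _ => ?_
  rw [Finset.sum_eq_single 0 (fun j _ hj => by simp [hj]) (by simp)]
  simp [torusChar_apply, mul_comm]

theorem torusDFT_rowDrop {x : ZMod n × ZMod n → ℝ} (hbot : ∀ i, x (i, 0) = 1)
    (htop : ∀ i, x (i, -1) = 0) {k : ZMod n × ZMod n} (hk : k.1 ≠ 0) :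
    torusDFT (rowDrop x) k = -((1 - torusChar k (-(0, 1))) * torusDFT x k) := by
  simp_rw [← torusDFT_sub_translate, sub_translate_eq_sub_rowDrop hbot htop, torusDFT_sub,
    torusDFT_bottomRow hk, zero_sub, neg_neg]

theorem norm_one_sub_torusChar_neg_snd_le (k₁ : ZMod n) (k₂ : ℕ) :
    ‖1 - torusChar (k₁, (k₂ : ZMod n)) (-(0, 1))‖ ≤ 2 * Real.pi * k₂ / n := by
  have hcast : -(k₂ : ZMod n) = ((-(k₂ : ℤ) : ℤ) : ZMod n) := by push_cast; rfl
  have hexp : torusChar (k₁, (k₂ : ZMod n)) (-(0, 1)) =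
      Complex.exp (Complex.I * ((-(2 * Real.pi * k₂ / n) : ℝ) : ℂ)) := by
    rw [torusChar_apply]
    simp only [Prod.fst_neg, Prod.snd_neg, neg_zero, mul_zero, zero_add, mul_neg, mul_one]
    rw [hcast, ZMod.stdAddChar_coe]
    congr 1
    push_cast
    ring
  rw [norm_sub_rev, hexp]
  refine Real.norm_exp_I_mul_ofReal_sub_one_le.trans_eq ?_
  rw [norm_neg, Real.norm_of_nonneg (by positivity)]

theorem sum_le_two_mul_norm_torusDFT {w : ZMod n × ZMod n → ℝ} (hw : ∀ a, 0 ≤ w a)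
    {k : ZMod n × ZMod n} {u : ℂ} (hu : ‖u‖ = 1)
    (hphase : ∀ a, w a ≠ 0 → 1 / 2 ≤ (u * torusChar k (-a)).re) :
    ∑ a, w a ≤ 2 * ‖torusDFT w k‖ := by
  have hterm (a : ZMod n × ZMod n) : w a * (1 / 2) ≤ (u * (w a * torusChar k (-a))).re := by
    rw [mul_left_comm, Complex.re_ofReal_mul]
    rcases eq_or_ne (w a) 0 with ha | ha
    · simp [ha]
    · exact mul_le_mul_of_nonneg_left (hphase a ha) (hw a)
  have hre : ∑ a, w a * (1 / 2) ≤ (u * torusDFT w k).re := by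
    rw [torusDFT, Finset.mul_sum, Complex.re_sum]
    exact Finset.sum_le_sum fun a _ => hterm a
  have hnorm : ‖u * torusDFT w k‖ = ‖torusDFT w k‖ := by rw [norm_mul, hu, one_mul]
  rw [← Finset.sum_mul] at hre
  linarith [hnorm ▸ Complex.re_le_norm (u * torusDFT w k)]

theorem exp_mul_torusChar_neg (k₁ k₂ : ℕ) (s : ℝ) (a : ZMod n × ZMod n) :
    Complex.exp ((Real.pi * k₂ : ℝ) * Complex.I) *
        torusChar ((k₁ : ZMod n), (k₂ : ZMod n)) (-a) =
      Complex.exp (((-(2 * Real.pi * (((k₁ - s * k₂) * a.1.val +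
        k₂ * (a.2.val - (n / 2 - s * a.1.val))) / n)) : ℝ) : ℂ) * Complex.I) := by
  have hn : (n : ℂ) ≠ 0 := by exact_mod_cast NeZero.ne n
  have hcast : (k₁ : ZMod n) * -a.1 + (k₂ : ZMod n) * -a.2 =
      ((-(k₁ * a.1.val + k₂ * a.2.val : ℤ) : ℤ) : ZMod n) := by
    push_cast
    simp only [ZMod.natCast_val, ZMod.cast_id', id_eq]
    ring
  rw [torusChar_apply, Prod.fst_neg, Prod.snd_neg, hcast, ZMod.stdAddChar_coe, ← Complex.exp_add]
  congr 1
  push_cast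
  field_simp
  ring

theorem half_le_re_exp_mul_torusChar {k₁ k₂ : ℕ} {s : ℝ} (hk₂ : 48 * k₂ ≤ n)
    (hk : |(k₁ : ℝ) - s * k₂| ≤ 1 / 8) {a : ZMod n × ZMod n}
    (ha : |(a.2.val : ℝ) - (n / 2 - s * a.1.val)| ≤ 2) :
    1 / 2 ≤ (Complex.exp ((Real.pi * k₂ : ℝ) * Complex.I) *
      torusChar ((k₁ : ZMod n), (k₂ : ZMod n)) (-a)).re := by
  have hn : (0 : ℝ) < n := by exact_mod_cast Nat.pos_of_neZero n
  have hk₂' : (48 : ℝ) * k₂ ≤ n := by exact_mod_cast hk₂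
  have hfst : |(k₁ : ℝ) - s * k₂| * a.1.val ≤ 1 / 8 * n := by
    gcongr
    exact_mod_cast (ZMod.val_lt a.1).le
  have hsnd : (k₂ : ℝ) * |(a.2.val : ℝ) - (n / 2 - s * a.1.val)| ≤ k₂ * 2 := by gcongr
  have hphase :
      |((k₁ - s * k₂) * a.1.val + k₂ * (a.2.val - (n / 2 - s * a.1.val))) / n| ≤ 1 / 6 := by
    rw [abs_div, abs_of_pos hn, div_le_iff₀ hn]
    refine (abs_add_le _ _).trans ?_
    rw [abs_mul, abs_mul, Nat.abs_cast, Nat.abs_cast]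
    linarith
  rw [exp_mul_torusChar_neg k₁ k₂ s a, Complex.exp_ofReal_mul_I_re, Real.cos_neg, ← Real.cos_abs,
    ← Real.cos_pi_div_three, abs_mul, abs_of_pos Real.two_pi_pos]
  refine Real.cos_le_cos_of_nonneg_of_le_pi (by positivity) (by linarith [Real.pi_pos]) ?_
  nlinarith [Real.pi_pos]

end RowDrop

section StraightEdge

variable {h : ℝ → ℝ} {s : ℝ} {n : ℕ} [NeZero n]

theorem line_apply_grid (hh : ∀ t ∈ Set.Icc (0 : ℝ) 1, h t = 1 / 2 - s * t) (i : ZMod n)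
    {u : ℝ × ℝ} (hu : u ∈ unitCell) :
    h (((i.val : ℤ) + u.1) / n) * n = n / 2 - s * i.val - s * u.1 := by
  have hn : (0 : ℝ) < n := by exact_mod_cast Nat.pos_of_neZero n
  have hi : (i.val : ℝ) + 1 ≤ n := by exact_mod_cast ZMod.val_lt i
  obtain ⟨⟨hu₀, hu₁⟩, -⟩ := hu
  rw [Int.cast_natCast, hh _ ⟨by positivity, (div_le_one hn).2 (by linarith)⟩]
  field_simp
  ring

theorem cellAverage_eq_one_of_add_one_le_line (hs : 0 ≤ s)
    (hh : ∀ t ∈ Set.Icc (0 : ℝ) 1, h t = 1 / 2 - s * t) {i : ZMod n} {j : ℤ}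
    (hj : j + 1 ≤ n / 2 - s * (i.val + 1)) : cellAverage h n i.val j = 1 := by
  refine cellAverage_eq_one fun u hu => ?_
  have hline := line_apply_grid hh i hu
  obtain ⟨⟨-, hu₁⟩, -, hu₂⟩ := hu
  rw [div_lt_iff₀ (by exact_mod_cast Nat.pos_of_neZero n), hline]
  linarith [mul_le_mul_of_nonneg_left hu₁.le hs]

theorem cellAverage_eq_zero_of_line_le (hs : 0 ≤ s)
    (hh : ∀ t ∈ Set.Icc (0 : ℝ) 1, h t = 1 / 2 - s * t) {i : ZMod n} {j : ℤ}
    (hj : n / 2 - s * i.val ≤ j) : cellAverage h n i.val j = 0 := by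
  refine cellAverage_eq_zero fun u hu => ?_
  have hline := line_apply_grid hh i hu
  obtain ⟨⟨hu₁, -⟩, hu₂, -⟩ := hu
  rw [le_div_iff₀ (by exact_mod_cast Nat.pos_of_neZero n), hline]
  linarith [mul_nonneg hs hu₁]

theorem pixelImage_line_bottom (hs₀ : 0 ≤ s) (hs₁ : s ≤ 1 / 4) (hc : Continuous h)
    (hh : ∀ t ∈ Set.Icc (0 : ℝ) 1, h t = 1 / 2 - s * t) (hn : 4 ≤ n) (i : ZMod n) :
    pixelImage n (horizonImage h) (i, 0) = 1 := by
  have hn' : (4 : ℝ) ≤ n := by exact_mod_cast hn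
  have hi : (i.val : ℝ) + 1 ≤ n := by exact_mod_cast ZMod.val_lt i
  rw [pixelImage_horizonImage n hc]
  refine cellAverage_eq_one_of_add_one_le_line hs₀ hh ?_
  have := mul_le_mul hs₁ hi (by positivity) (by norm_num)
  simp only [ZMod.val_zero, Nat.cast_zero, Int.cast_zero, zero_add]
  linarith

theorem pixelImage_line_top (hs : 0 ≤ s) (hc : Continuous h)
    (hh : ∀ t ∈ Set.Icc (0 : ℝ) 1, h t = 1 / 2 - s * t) (hn : 2 ≤ n) (i : ZMod n) :
    pixelImage n (horizonImage h) (i, -1) = 0 := by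
  rw [pixelImage_horizonImage n hc]
  refine cellAverage_eq_zero_of_line_le hs hh ?_
  obtain ⟨m, rfl⟩ : ∃ m, n = m + 1 := ⟨n - 1, by lia⟩
  have hm : (1 : ℝ) ≤ m := by exact_mod_cast Nat.succ_le_succ_iff.1 hn
  have := mul_nonneg hs (Nat.cast_nonneg (α := ℝ) i.val)
  rw [ZMod.val_neg_one]
  push_cast
  linarith

theorem rowDrop_pixelImage_nonneg (hc : Continuous h) (a : ZMod n × ZMod n) :
    0 ≤ rowDrop (pixelImage n (horizonImage h)) a := by
  rw [rowDrop, pixelImage_horizonImage n hc]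
  split_ifs with ha
  · rfl
  · simp only [Prod.fst_sub, Prod.snd_sub, sub_zero, intCast_val_sub_one ha]
    exact sub_nonneg.2 (cellAverage_antitone_snd h n _ (by lia))

theorem abs_sub_line_le_of_rowDrop_ne_zero (hs₀ : 0 ≤ s) (hs₁ : s ≤ 1 / 4) (hc : Continuous h)
    (hh : ∀ t ∈ Set.Icc (0 : ℝ) 1, h t = 1 / 2 - s * t) {a : ZMod n × ZMod n}
    (ha : rowDrop (pixelImage n (horizonImage h)) a ≠ 0) :
    |(a.2.val : ℝ) - (n / 2 - s * a.1.val)| ≤ 2 := by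
  contrapose! ha
  rw [rowDrop, pixelImage_horizonImage n hc]
  split_ifs with ha₂
  · rfl
  simp only [Prod.fst_sub, Prod.snd_sub, sub_zero, intCast_val_sub_one ha₂]
  rcases lt_abs.1 ha with hlt | hlt
  · rw [cellAverage_eq_zero_of_line_le hs₀ hh, cellAverage_eq_zero_of_line_le hs₀ hh, sub_zero] <;>
      push_cast <;> linarith
  · rw [cellAverage_eq_one_of_add_one_le_line hs₀ hh,
      cellAverage_eq_one_of_add_one_le_line hs₀ hh, sub_self] <;> push_cast <;> linarith

theorem sq_le_norm_torusDFT_line (hs₀ : 0 ≤ s) (hs₁ : s ≤ 1 / 4) (hc : Continuous h)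
    (hh : ∀ t ∈ Set.Icc (0 : ℝ) 1, h t = 1 / 2 - s * t) {k₁ k₂ : ℕ} (hk₁ : 0 < k₁)
    (hk₁n : k₁ < n) (hk₂ : 0 < k₂) (hk₂n : 48 * k₂ ≤ n) (hk : |(k₁ : ℝ) - s * k₂| ≤ 1 / 8) :
    (n : ℝ) ^ 2 ≤ 4 * Real.pi * k₂ *
      ‖torusDFT (pixelImage n (horizonImage h)) ((k₁ : ZMod n), (k₂ : ZMod n))‖ := by
  have hn : (0 : ℝ) < n := by exact_mod_cast Nat.pos_of_neZero n
  have hk₁' : (k₁ : ZMod n) ≠ 0 := by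
    rw [Ne, ZMod.natCast_eq_zero_iff]
    exact Nat.not_dvd_of_pos_of_lt hk₁ hk₁n
  set T := torusDFT (pixelImage n (horizonImage h)) ((k₁ : ZMod n), (k₂ : ZMod n))
  have hbot (i : ZMod n) := pixelImage_line_bottom hs₀ hs₁ hc hh (n := n) (by lia) i
  have htop (i : ZMod n) := pixelImage_line_top hs₀ hc hh (n := n) (by lia) i
  have hdrop : (n : ℝ) ≤ 2 * (2 * Real.pi * k₂ / n * ‖T‖) := by
    calc (n : ℝ)
        ≤ 2 * ‖torusDFT (rowDrop (pixelImage n (horizonImage h))) (k₁, k₂)‖ := by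
          rw [← sum_rowDrop hbot htop]
          exact sum_le_two_mul_norm_torusDFT (rowDrop_pixelImage_nonneg hc)
            (Complex.norm_exp_ofReal_mul_I _) fun a ha => half_le_re_exp_mul_torusChar hk₂n hk
              (abs_sub_line_le_of_rowDrop_ne_zero hs₀ hs₁ hc hh ha)
      _ ≤ 2 * (2 * Real.pi * k₂ / n * ‖T‖) := by
          rw [torusDFT_rowDrop hbot htop hk₁', norm_neg, norm_mul]
          gcongr
          exact norm_one_sub_torusChar_neg_snd_le _ _
  calc (n : ℝ) ^ 2 = n * n := sq _
    _ ≤ 2 * (2 * Real.pi * k₂ / n * ‖T‖) * n := by gcongr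
    _ = 4 * Real.pi * k₂ * ‖T‖ := by
      field_simp
      ring

end StraightEdge

/-! ### Straight contours in every Hölder class -/

open scoped ContDiff in
theorem exists_contDiff_hasCompactSupport_eqOn_id : ∃ ψ : ℝ → ℝ, ContDiff ℝ ∞ ψ ∧
    HasCompactSupport ψ ∧ Set.EqOn ψ id (Set.Icc 0 1) := by
  let f : ContDiffBump (0 : ℝ) := ⟨1, 2, one_pos, one_lt_two⟩
  refine ⟨fun t => t * f t, contDiff_id.mul f.contDiff, f.hasCompactSupport.mul_left, ?_⟩
  intro t ht
  have hft : f t = 1 := f.one_of_mem_closedBall <| by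
    rw [mem_closedBall_zero_iff, Real.norm_of_nonneg ht.1]
    exact ht.2
  simp [hft]

theorem le_mul_rpow_of_le_of_le_mul {M d y β : ℝ} (hM : 0 ≤ M) (hd : 0 ≤ d)
    (hβ : β ∈ Set.Icc 0 1) (h : y ≤ M) (hd' : y ≤ M * d) : y ≤ M * d ^ β := by
  rcases le_total d 1 with hd1 | hd1
  · exact hd'.trans (mul_le_mul_of_nonneg_left
      (Real.self_le_rpow_of_le_one hd hd1 hβ.2) hM)
  · exact h.trans (le_mul_of_one_le_right hM (Real.one_le_rpow hd1 hβ.1))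

open scoped ContDiff in
theorem exists_holder_bound_iteratedDeriv {ψ : ℝ → ℝ} (hψ : ContDiff ℝ ∞ ψ)
    (hc : HasCompactSupport ψ) (k : ℕ) {β : ℝ} (hβ : β ∈ Set.Icc 0 1) :
    ∃ M : ℝ, 0 < M ∧ ∀ t t' : ℝ,
      |iteratedDeriv k ψ t - iteratedDeriv k ψ t'| ≤ M * |t - t'| ^ β := by
  have hbdd (l : ℕ) : ∃ A, ∀ t, ‖iteratedDeriv l ψ t‖ ≤ A := by
    have hcont := hψ.continuous_iteratedDeriv l (by exact_mod_cast le_top)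
    refine hcont.bounded_above_of_compact_support ?_
    clear hcont
    induction l with
    | zero => simpa using hc
    | succ l ih =>
      rw [iteratedDeriv_succ]
      exact ih.deriv
  have hdiff : Differentiable ℝ (iteratedDeriv k ψ) :=
    hψ.differentiable_iteratedDeriv k (by exact_mod_cast WithTop.coe_lt_top _)
  obtain ⟨A, hA⟩ := hbdd k
  obtain ⟨B, hB⟩ := hbdd (k + 1)
  have hA₀ : 0 ≤ A := (norm_nonneg _).trans (hA 0)
  have hB₀ : 0 ≤ B := (norm_nonneg _).trans (hB 0)
  refine ⟨2 * A + B + 1, by positivity, fun t t' => ?_⟩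
  refine le_mul_rpow_of_le_of_le_mul (by positivity) (abs_nonneg _) hβ ?_ ?_
  · linarith [norm_sub_le_of_le (hA t) (hA t'), Real.norm_eq_abs (iteratedDeriv k ψ t -
      iteratedDeriv k ψ t')]
  · refine (Convex.norm_image_sub_le_of_norm_deriv_le (fun x _ => hdiff x)
      (fun x _ => ?_) convex_univ (Set.mem_univ t') (Set.mem_univ t)).trans
      (mul_le_mul_of_nonneg_right (by linarith : B ≤ _) (abs_nonneg _))
    rw [← iteratedDeriv_succ]
    exact hB x

open scoped ContDiff in
theorem exists_forall_const_sub_mul_mem_holderClass {ψ : ℝ → ℝ} (hψ : ContDiff ℝ ∞ ψ)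
    (hc : HasCompactSupport ψ) {k : ℕ} {α C : ℝ} (hC : 0 < C) (hα : α - k ∈ Set.Icc 0 1) (b : ℝ) :
    ∃ s₀ : ℝ, 0 < s₀ ∧ ∀ s ∈ Set.Icc 0 s₀, (fun t => b - s * ψ t) ∈ HolderClass k α C := by
  obtain ⟨M, hM, hbound⟩ := exists_holder_bound_iteratedDeriv hψ hc k hα
  refine ⟨C / M, by positivity, fun s hs => ⟨fun l _ => ?_, fun t t' => ?_⟩⟩
  · have hsmooth : ContDiff ℝ ∞ fun t => b - s * ψ t := contDiff_const.sub (contDiff_const.mul hψ)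
    exact hsmooth.differentiable_iteratedDeriv l (by exact_mod_cast WithTop.coe_lt_top _)
  · have hsub : iteratedDeriv k (fun t => b - s * ψ t) t -
        iteratedDeriv k (fun t => b - s * ψ t) t' =
        -(s * (iteratedDeriv k ψ t - iteratedDeriv k ψ t')) := by
      rcases Nat.eq_zero_or_pos k with rfl | hk
      · simp only [iteratedDeriv_zero]
        ring
      · simp only [iteratedDeriv_const_sub hk, iteratedDeriv_neg, iteratedDeriv_const_mul_field]
        ring
    rw [hsub, abs_neg, abs_mul, abs_of_nonneg hs.1]
    calc s * |iteratedDeriv k ψ t - iteratedDeriv k ψ t'|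
        ≤ C / M * (M * |t - t'| ^ (α - k)) :=
          mul_le_mul hs.2 (hbound t t') (abs_nonneg _) (by positivity)
      _ = C * |t - t'| ^ (α - k) := by field_simp

theorem exists_straight_contours {k l : ℕ} {α β C D : ℝ} (hC : 0 < C) (hD : 0 < D)
    (hα : α - k ∈ Set.Icc 0 1) (hβ : β - l ∈ Set.Icc 0 1) :
    ∃ h : ℝ → ℝ → ℝ, (∀ s, Continuous (h s)) ∧
      (∀ s, ∀ t ∈ Set.Icc (0 : ℝ) 1, h s t = 1 / 2 - s * t) ∧
      ∃ s₀ : ℝ, 0 < s₀ ∧ ∀ s ∈ Set.Icc 0 s₀, h s ∈ HolderClass k α C ∩ HolderClass l β D := by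
  obtain ⟨ψ, hψ, hc, hψ_id⟩ := exists_contDiff_hasCompactSupport_eqOn_id
  obtain ⟨s₁, hs₁, h₁⟩ := exists_forall_const_sub_mul_mem_holderClass hψ hc hC hα (1 / 2)
  obtain ⟨s₂, hs₂, h₂⟩ := exists_forall_const_sub_mul_mem_holderClass hψ hc hD hβ (1 / 2)
  refine ⟨fun s t => 1 / 2 - s * ψ t,
    fun s => continuous_const.sub (continuous_const.mul hψ.continuous), fun s t ht => ?_,
    min s₁ s₂, lt_min hs₁ hs₂, fun s hs => ⟨?_, ?_⟩⟩
  · simp [hψ_id ht]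
  · exact h₁ s ⟨hs.1, hs.2.trans (min_le_left _ _)⟩
  · exact h₂ s ⟨hs.1, hs.2.trans (min_le_right _ _)⟩

/-! ### The lower bound -/

theorem half_le_norm_one_sub_sq_add (z : ℂ) : 1 / 2 ≤ ‖1 - z‖ ^ 2 + ‖z‖ ^ 2 := by
  have htri : (1 : ℝ) ≤ ‖1 - z‖ + ‖z‖ := by simpa using norm_add_le (1 - z) z
  nlinarith [sq_nonneg (‖1 - z‖ - ‖z‖)]

/-- The filter `G` cannot adapt to `r`: at each frequency it pays for the power there of some
member of the family, or for the noise of all members. -/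
theorem exists_card_mul_min_le {ι κ : Type*} {R : Finset ι} (hR : R.Nonempty) {S : Finset κ}
    {P : ι → κ → ℝ} (hP : ∀ r k, 0 ≤ P r k) (G : κ → ℂ) {v τ : ℝ} (hv : 0 ≤ v) (hτ : 0 ≤ τ)
    (hpower : ∀ k ∈ S, ∃ r ∈ R, τ ≤ P r k) :
    ∃ r ∈ R, S.card * (min τ (R.card * v) / 2) ≤
      R.card * ∑ k ∈ S, (‖1 - G k‖ ^ 2 * P r k + v * ‖G k‖ ^ 2) := by
  set m := min τ (R.card * v)
  have hm : 0 ≤ m := le_min hτ (by positivity)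
  have hfreq (k : κ) (hk : k ∈ S) :
      m / 2 ≤ ∑ r ∈ R, (‖1 - G k‖ ^ 2 * P r k + v * ‖G k‖ ^ 2) := by
    obtain ⟨r₀, hr₀, hle⟩ := hpower k hk
    have hsum : m ≤ ∑ r ∈ R, P r k := (min_le_left _ _).trans <|
      hle.trans (Finset.single_le_sum (f := fun r => P r k) (fun r _ => hP r k) hr₀)
    calc m / 2 ≤ (‖1 - G k‖ ^ 2 + ‖G k‖ ^ 2) * m := by
          nlinarith [half_le_norm_one_sub_sq_add (G k)]
      _ = ‖1 - G k‖ ^ 2 * m + m * ‖G k‖ ^ 2 := by ring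
      _ ≤ ‖1 - G k‖ ^ 2 * ∑ r ∈ R, P r k + R.card * v * ‖G k‖ ^ 2 := by
          gcongr
          exact min_le_right _ _
      _ = ∑ r ∈ R, (‖1 - G k‖ ^ 2 * P r k + v * ‖G k‖ ^ 2) := by
          rw [Finset.sum_add_distrib, ← Finset.mul_sum, Finset.sum_const, nsmul_eq_mul, mul_assoc]
  refine Finset.exists_le_of_sum_le hR ?_
  rw [Finset.sum_const, nsmul_eq_mul, ← Finset.mul_sum, Finset.sum_comm]
  refine mul_le_mul_of_nonneg_left ?_ (Nat.cast_nonneg _)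
  rw [← nsmul_eq_mul]
  exact Finset.card_nsmul_le_sum S _ _ hfreq

/-- The frequencies `(k₁, k₂)` with `1 ≤ k₁ ≤ M` and `K ≤ k₂ < 2K`: those that are met by the
normal directions of edges of slope at most `M / K`. -/
def edgeFrequencies (n M K : ℕ) : Finset (ZMod n × ZMod n) :=
  (Finset.Icc 1 M ×ˢ Finset.Ico K (2 * K)).image fun q => ((q.1 : ZMod n), (q.2 : ZMod n))

theorem card_edgeFrequencies {n M K : ℕ} (hM : M < n) (hK : 2 * K ≤ n) :
    (edgeFrequencies n M K).card = M * K := by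
  rw [edgeFrequencies, Finset.card_image_of_injOn, Finset.card_product, Nat.card_Icc,
    Nat.card_Ico, Nat.add_sub_cancel, two_mul, Nat.add_sub_cancel]
  rintro ⟨k₁, k₂⟩ hk ⟨l₁, l₂⟩ hl heq
  simp only [Finset.coe_product, Set.mem_prod, Finset.mem_coe, Finset.mem_Icc,
    Finset.mem_Ico] at hk hl
  obtain ⟨h₁, h₂⟩ := Prod.ext_iff.1 heq
  have hinj := CharP.natCast_injOn_Iio (ZMod n) n
  exact Prod.ext (hinj (Set.mem_Iio.2 (by lia)) (Set.mem_Iio.2 (by lia)) h₁)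
    (hinj (Set.mem_Iio.2 (by lia)) (Set.mem_Iio.2 (by lia)) h₂)

theorem exists_slope_close_to {M K k₁ k₂ : ℕ} (hk₁ : k₁ ≤ M) (hK : 0 < K) (hk₂ : K ≤ k₂)
    (hk₂' : k₂ ≤ 2 * K) : ∃ r ≤ 16 * M, |(k₁ : ℝ) - r / (16 * K) * k₂| ≤ 1 / 8 := by
  have : (0 : ℝ) < K := by exact_mod_cast hK
  have : (0 : ℝ) < k₂ := by exact_mod_cast hK.trans_le hk₂
  have hk₂₁ : (k₂ : ℝ) ≤ 2 * K := by exact_mod_cast hk₂'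
  have hdist : (k₁ : ℝ) - ((16 * K * k₁ / k₂ : ℕ) : ℝ) / (16 * K) * k₂ =
      ((16 * K * k₁ % k₂ : ℕ) : ℝ) / (16 * K) := by
    have hdiv : (k₂ : ℝ) * (16 * K * k₁ / k₂ : ℕ) + (16 * K * k₁ % k₂ : ℕ) = 16 * K * k₁ := by
      exact_mod_cast Nat.div_add_mod (16 * K * k₁) k₂
    field_simp
    linarith
  refine ⟨16 * K * k₁ / k₂, ?_, ?_⟩
  · calc 16 * K * k₁ / k₂ ≤ 16 * K * k₁ / K := Nat.div_le_div_left hk₂ hK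
      _ = 16 * k₁ := by rw [mul_right_comm, Nat.mul_div_cancel _ hK]
      _ ≤ 16 * M := by lia
  · have hmod : ((16 * K * k₁ % k₂ : ℕ) : ℝ) ≤ k₂ := by
      exact_mod_cast (Nat.mod_lt _ (hK.trans_le hk₂)).le
    rw [hdist, abs_of_nonneg (by positivity), div_le_iff₀ (by positivity)]
    linarith

theorem exists_slope_power_ge {n : ℕ} [NeZero n] {M K : ℕ} (hMK : 4 * M ≤ K) (hK : 0 < K)
    (hn : 96 * K ≤ n) {h : ℝ → ℝ → ℝ} (hc : ∀ s, Continuous (h s))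
    (hh : ∀ s, ∀ t ∈ Set.Icc (0 : ℝ) 1, h s t = 1 / 2 - s * t) {k : ZMod n × ZMod n}
    (hk : k ∈ edgeFrequencies n M K) :
    ∃ r ∈ Finset.range (16 * M + 1), 1 / (8 * Real.pi * K) ^ 2 ≤
      ‖torusDFT (pixelImage n (horizonImage (h (r / (16 * K))))) k‖ ^ 2 / (n : ℝ) ^ 4 := by
  have hn' : (0 : ℝ) < n := by exact_mod_cast Nat.pos_of_neZero n
  have : (0 : ℝ) < K := by exact_mod_cast hK
  simp only [edgeFrequencies, Finset.mem_image, Finset.mem_product, Finset.mem_Icc,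
    Finset.mem_Ico] at hk
  obtain ⟨⟨k₁, k₂⟩, ⟨⟨hk₁, hk₁M⟩, hk₂, hk₂K⟩, rfl⟩ := hk
  obtain ⟨r, hr, hdist⟩ := exists_slope_close_to hk₁M hK hk₂ hk₂K.le
  have hslope : (r : ℝ) / (16 * K) ≤ 1 / 4 := by
    rw [div_le_iff₀ (by positivity)]
    have : (r : ℝ) ≤ 4 * K := by exact_mod_cast (show r ≤ 4 * K by lia)
    linarith
  refine ⟨r, Finset.mem_range.2 (by lia), ?_⟩
  set T := torusDFT (pixelImage n (horizonImage (h (r / (16 * K)))))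
    ((k₁ : ZMod n), (k₂ : ZMod n))
  have hT : (n : ℝ) ^ 2 ≤ 8 * Real.pi * K * ‖T‖ := by
    calc (n : ℝ) ^ 2 ≤ 4 * Real.pi * k₂ * ‖T‖ :=
          sq_le_norm_torusDFT_line (by positivity) hslope (hc _) (hh _) hk₁ (by lia) (by lia)
            (by lia) hdist
      _ ≤ 4 * Real.pi * (2 * K) * ‖T‖ := by
          gcongr
          exact_mod_cast hk₂K.le
      _ = 8 * Real.pi * K * ‖T‖ := by ring
  rw [div_le_div_iff₀ (by positivity) (by positivity), one_mul, mul_comm, ← mul_pow]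
  calc (n : ℝ) ^ 4 = ((n : ℝ) ^ 2) ^ 2 := by ring
    _ ≤ (8 * Real.pi * K * ‖T‖) ^ 2 := by gcongr

theorem exists_slope_risk_ge {g : ℤ → ℤ → ℝ} (hg : Summable fun p : ℤ × ℤ => g p.1 p.2)
    (σ : ℝ≥0) {n : ℕ} [NeZero n] {M K : ℕ} (hM : 0 < M) (hMK : 4 * M ≤ K) (hn : 96 * K ≤ n)
    {h : ℝ → ℝ → ℝ} (hc : ∀ s, Continuous (h s))
    (hh : ∀ s, ∀ t ∈ Set.Icc (0 : ℝ) 1, h s t = 1 / 2 - s * t) :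
    ∃ r ≤ 16 * M, ENNReal.ofReal (K / 34 *
        min (1 / (8 * Real.pi * K) ^ 2) (16 * M * (σ ^ 2 / (n : ℝ) ^ 2))) ≤
      risk σ n (horizonImage (h (r / (16 * K)))) g := by
  have hM' : (1 : ℝ) ≤ M := by exact_mod_cast hM
  obtain ⟨r, hr, hle⟩ := exists_card_mul_min_le (R := Finset.range (16 * M + 1)) ⟨0, by simp⟩
    (P := fun r k => ‖torusDFT (pixelImage n (horizonImage (h (r / (16 * K))))) k‖ ^ 2 /
      (n : ℝ) ^ 4) (fun r k => by positivity) (torusDFT (periodize g n))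
    (v := σ ^ 2 / (n : ℝ) ^ 2) (by positivity) (τ := 1 / (8 * Real.pi * K) ^ 2) (by positivity)
    fun k hk => exists_slope_power_ge hMK (by lia) hn hc hh hk
  rw [card_edgeFrequencies (by lia) (by lia), Finset.card_range] at hle
  refine ⟨r, Nat.lt_succ_iff.1 (Finset.mem_range.1 hr), ?_⟩
  rw [risk_eq_sum_frequencies hg]
  refine ENNReal.ofReal_le_ofReal (le_trans ?_ (Finset.sum_le_sum_of_subset_of_nonneg
    (Finset.subset_univ (edgeFrequencies n M K)) fun k _ _ => by positivity))
  set B := ∑ k ∈ edgeFrequencies n M K, (‖1 - torusDFT (periodize g n) k‖ ^ 2 *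
    (‖torusDFT (pixelImage n (horizonImage (h (r / (16 * K))))) k‖ ^ 2 / (n : ℝ) ^ 4) +
      σ ^ 2 / (n : ℝ) ^ 2 * ‖torusDFT (periodize g n) k‖ ^ 2)
  set m := min (1 / (8 * Real.pi * K) ^ 2) (16 * M * (σ ^ 2 / (n : ℝ) ^ 2))
  have hB : 0 ≤ B := Finset.sum_nonneg fun k _ => by positivity
  have hmin : m ≤ min (1 / (8 * Real.pi * K) ^ 2) (((16 * M + 1 : ℕ) : ℝ) *
      (σ ^ 2 / (n : ℝ) ^ 2)) := by
    refine min_le_min le_rfl (mul_le_mul_of_nonneg_right ?_ (by positivity))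
    push_cast
    linarith
  have hchain : M * (K / 34 * m) ≤ M * B := by
    have h₁ : (M : ℝ) * K * (m / 2) ≤ (16 * M + 1) * B := by
      push_cast at hle hmin
      exact le_trans (by gcongr) hle
    nlinarith
  exact le_of_mul_le_mul_left hchain (by linarith)

theorem exists_frequency_scale {E n : ℕ} (hn : (96 * E) ^ 3 ≤ n) (hn₀ : 0 < n) :
    ∃ M : ℕ, 0 < M ∧ 96 * (E * M) ≤ n ∧
      (M : ℝ) ∈ Set.Icc ((n : ℝ) ^ (2 / 3 : ℝ) / 2) ((n : ℝ) ^ (2 / 3 : ℝ)) := by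
  have hn' : (1 : ℝ) ≤ n := by exact_mod_cast hn₀
  have hx : 1 ≤ (n : ℝ) ^ (2 / 3 : ℝ) := Real.one_le_rpow hn' (by norm_num)
  have hM : 0 < ⌊(n : ℝ) ^ (2 / 3 : ℝ)⌋₊ := Nat.floor_pos.2 hx
  have hM' : (1 : ℝ) ≤ ⌊(n : ℝ) ^ (2 / 3 : ℝ)⌋₊ := by exact_mod_cast hM
  have hfloor := Nat.floor_le (zero_le_one.trans hx)
  refine ⟨⌊(n : ℝ) ^ (2 / 3 : ℝ)⌋₊, hM, ?_,
    by linarith [Nat.lt_floor_add_one ((n : ℝ) ^ (2 / 3 : ℝ))], hfloor⟩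
  have hroot : (96 * E : ℝ) ≤ (n : ℝ) ^ (1 / 3 : ℝ) := by
    rw [one_div]
    refine (Real.le_rpow_inv_iff_of_pos (by positivity) (by positivity) (by norm_num)).2 ?_
    exact_mod_cast hn
  have hle : (96 * (E * ⌊(n : ℝ) ^ (2 / 3 : ℝ)⌋₊) : ℝ) ≤ n := by
    calc (96 * (E * ⌊(n : ℝ) ^ (2 / 3 : ℝ)⌋₊) : ℝ)
        = 96 * E * ⌊(n : ℝ) ^ (2 / 3 : ℝ)⌋₊ := by ring
      _ ≤ (n : ℝ) ^ (1 / 3 : ℝ) * (n : ℝ) ^ (2 / 3 : ℝ) := by gcongr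
      _ = n := by
          rw [← Real.rpow_add (by positivity)]
          norm_num
  exact_mod_cast hle

theorem min_mul_inv_le_frequency_bound {E M x y v : ℝ} (hE : 0 < E) (hM : 0 < M) (hx : 0 < x)
    (hMx : M ∈ Set.Icc (x / 2) x) (hy : y ^ 2 = x ^ 3) (hv : 0 ≤ v) :
    min (1 / (2176 * Real.pi ^ 2 * E)) (2 / 17 * E * v) * x⁻¹ ≤
      E * M / 34 * min (1 / (8 * Real.pi * (E * M)) ^ 2) (16 * M * (v / y ^ 2)) := by
  rw [mul_min_of_nonneg _ _ (by positivity), min_mul_of_nonneg _ _ (by positivity), hy]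
  refine min_le_min ?_ ?_
  · calc 1 / (2176 * Real.pi ^ 2 * E) * x⁻¹ ≤ 1 / (2176 * Real.pi ^ 2 * E) * M⁻¹ := by
          gcongr
          exact hMx.2
      _ = E * M / 34 * (1 / (8 * Real.pi * (E * M)) ^ 2) := by
          field_simp
          norm_num
  · calc 2 / 17 * E * v * x⁻¹ = 8 / 17 * E * v * ((x / 2) ^ 2 / x ^ 3) := by
          field_simp
          ring
      _ ≤ 8 / 17 * E * v * (M ^ 2 / x ^ 3) := by
          gcongr
          exact hMx.1
      _ = E * M / 34 * (16 * M * (v / x ^ 3)) := by ring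

theorem exists_iSup_risk_ge {ord : ℝ → ℕ} {α C : ℝ} (hα : α - ord α ∈ Set.Icc 0 1)
    (h1 : (1 : ℝ) - ord 1 ∈ Set.Icc 0 1) (hC : 0 < C) {σ : ℝ≥0} (hσ : 0 < σ) :
    ∃ c : ℝ, 0 < c ∧ ∃ n₀ : ℕ, ∀ (n : ℕ) [NeZero n], n₀ < n → ∀ g : ℤ → ℤ → ℝ,
      Summable (fun p : ℤ × ℤ => g p.1 p.2) →
        ENNReal.ofReal (c * (n : ℝ) ^ (-(2 / 3) : ℝ)) ≤
          ⨆ f ∈ horizonClass ord α C, risk σ n f g := by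
  obtain ⟨h, hc, hline, s₀, hs₀, hmem⟩ := exists_straight_contours hC one_pos hα h1
  obtain ⟨E, hE⟩ := exists_nat_ge (max 4 (1 / s₀))
  have hE₄ : 4 ≤ E := by exact_mod_cast (le_max_left _ _).trans hE
  have hE₀ : (0 : ℝ) < E := by exact_mod_cast (by lia : 0 < E)
  have : (0 : ℝ) < σ := hσ
  refine ⟨min (1 / (2176 * Real.pi ^ 2 * E)) (2 / 17 * E * σ ^ 2), by positivity,
    (96 * E) ^ 3, fun n _ hn g hg => ?_⟩
  have hn₀ : (0 : ℝ) < n := by exact_mod_cast Nat.pos_of_neZero n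
  obtain ⟨M, hM, hEM, hMx⟩ := exists_frequency_scale hn.le (Nat.pos_of_neZero n)
  have hM₀ : (0 : ℝ) < M := by exact_mod_cast hM
  obtain ⟨r, hr, hle⟩ := exists_slope_risk_ge hg σ hM (Nat.mul_le_mul_right M hE₄) hEM hc hline
  have hslope : (r : ℝ) / (16 * (E * M : ℕ)) ≤ s₀ := by
    have hr' : (r : ℝ) ≤ 16 * M := by exact_mod_cast hr
    have hEs : 1 ≤ E * s₀ := (div_le_iff₀ hs₀).1 ((le_max_right _ _).trans hE)
    rw [div_le_iff₀ (by positivity)]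
    push_cast
    nlinarith
  have hsq : (n : ℝ) ^ 2 = ((n : ℝ) ^ (2 / 3 : ℝ)) ^ 3 := by
    rw [← Real.rpow_mul_natCast hn₀.le, ← Real.rpow_natCast]
    norm_num
  refine le_iSup₂_of_le _ ⟨_, hmem _ ⟨by positivity, hslope⟩, rfl⟩
    (le_trans (ENNReal.ofReal_le_ofReal ?_) hle)
  rw [Real.rpow_neg hn₀.le, Nat.cast_mul]
  exact min_mul_inv_le_frequency_bound hE₀ hM₀ (by positivity) hMx hsq (by positivity)

/-! ### The rate of linear filters -/

theorem sub_ord_mem_Icc {ord : ℝ → ℕ}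
    (hord : ord = (fun a : ℝ => ⌊a⌋₊) ∨ ord = (fun a : ℝ => ⌈a⌉₊ - 1)) {a : ℝ} (ha : 0 < a) :
    a - ord a ∈ Set.Icc 0 1 := by
  rcases hord with rfl | rfl
  · constructor <;> linarith [Nat.floor_le ha.le, Nat.lt_floor_add_one a]
  · push_cast [Nat.one_le_ceil_iff.2 ha]
    constructor <;> linarith [Nat.le_ceil a, Nat.ceil_lt_add_one ha.le]

end HorizonFilter

end

theorem theorem2_general {ord : ℝ → ℕ} {α C : ℝ} (hα : α - ord α ∈ Set.Icc 0 1)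
    (h1 : (1 : ℝ) - ord 1 ∈ Set.Icc 0 1) (hC : 0 < C) {σ : ℝ≥0} (hσ : 0 < σ) :
    ∃ c₁ c₂ : ℝ, 0 < c₁ ∧ 0 < c₂ ∧ ∃ n₀ : ℕ, ∀ (n : ℕ) [NeZero n], n₀ < n →
      (∀ g : ℤ → ℤ → ℝ, Summable (fun p : ℤ × ℤ => g p.1 p.2) →
        ENNReal.ofReal (c₁ * (n : ℝ) ^ (-(2 / 3) : ℝ)) ≤
          ⨆ f ∈ HorizonFilter.horizonClass ord α C, HorizonFilter.risk σ n f g) ∧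
      ∃ g, HorizonFilter.IsAdmissible g ∧
        ⨆ f ∈ HorizonFilter.horizonClass ord α C, HorizonFilter.risk σ n f g ≤
          ENNReal.ofReal (c₂ * (n : ℝ) ^ (-(2 / 3) : ℝ)) := by
  obtain ⟨c, hc, n₀, hlower⟩ := HorizonFilter.exists_iSup_risk_ge hα h1 hC hσ
  refine ⟨c, 32 + 25 * σ ^ 2, hc, by positivity, max n₀ 64, fun n _ hn =>
    ⟨hlower n ((le_max_left _ _).trans_lt hn), ?_⟩⟩
  obtain ⟨g, hg, hupper⟩ := HorizonFilter.exists_isAdmissible_risk_le h1 α C σ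
    ((le_max_right n₀ 64).trans hn.le)
  exact ⟨g, hg, iSup₂_le hupper⟩

/-- The two choices of `ord` are the two usual conventions for the Hölder classes: they differ
only at integer smoothness (with the second one, `Hölder^1(1)` consists of the functions that are
Lipschitz with constant one). The claim is made for both. -/
theorem theorem2 (ord : ℝ → ℕ)
    (hord : ord = (fun a : ℝ => ⌊a⌋₊) ∨ ord = (fun a : ℝ => ⌈a⌉₊ - 1))
    (α C : ℝ) (hα : 0 < α) (hC : 0 < C) (σ : ℝ≥0) (hσ : 0 < σ) :
    ∃ c₁ c₂ : ℝ, 0 < c₁ ∧ 0 < c₂ ∧ ∃ n₀ : ℕ, ∀ (n : ℕ) [NeZero n], n₀ < n →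
      ENNReal.ofReal (c₁ * (n : ℝ) ^ (-(2 / 3) : ℝ)) ≤ HorizonFilter.minimaxRisk ord α C σ n ∧
      HorizonFilter.minimaxRisk ord α C σ n ≤ ENNReal.ofReal (c₂ * (n : ℝ) ^ (-(2 / 3) : ℝ)) := by
  obtain ⟨c₁, c₂, hc₁, hc₂, n₀, H⟩ := theorem2_general
    (HorizonFilter.sub_ord_mem_Icc hord hα) (HorizonFilter.sub_ord_mem_Icc hord one_pos) hC hσ
  refine ⟨c₁, c₂, hc₁, hc₂, n₀, fun n _ hn => ⟨le_iInf₂ fun g hg => ?_, ?_⟩⟩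
  · exact (H n hn).1 g hg.hasSum_one.summable
  · obtain ⟨g, hg, hle⟩ := (H n hn).2
    exact iInf₂_le_of_le g hg hle
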